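/- Let $a\in(0,\infty)$, let $S^1=\mathbb{R}/\mathbb{Z}$, and let $\mathbb{Y}=[1,\infty)\times S^1$ carry the Riemannian metric $g=dx^2+(1+\frac{x}{a})^{-2a}dy^2$, with Riemannian measure $d\mu=(1+\frac{x}{a})^{-a}dx\,dy$. Let $\underline{\Delta}_{\mathbb{Y}}$ be the Dirichlet Laplacian on $L^2(\mathbb{Y})=L^2(\mathbb{Y},d\mu;\mathbb{C})$, that is, the Friedrichs extension of $$\Delta_{\mathbb{Y}}=\partial_x^2-\frac{1}{1+\frac{x}{a}}\partial_x+\Big(1+\frac{x}{a}\Big)^{2a}\partial_y^2$$ acting on the smooth functions with compact support in $(1,\infty)\times S^1$. For $n\in\mathbb{Z}$ let $L^2_n=L^2([1,\infty),(1+\frac{x}{a})^{-a}dx)\otimes e^{2\pi i n y}\subset L^2(\mathbb{Y})$, and let $L^2_{\mathcal{H}}(\mathbb{Y})=L^2_0$ be the zero-Fourier-mode subspace. An operator has discrete spectrum if each point of its spectrum is an isolated point of the spectrum and an eigenvalue of finite multiplicity. Then: 1. The subspace $(L^2_{\mathcal{H}}(\mathbb{Y}))^{\perp}$ reduces $\underline{\Delta}_{\mathbb{Y}}$,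 and the restriction of $\underline{\Delta}_{\mathbb{Y}}$ to $(L^2_{\mathcal{H}}(\mathbb{Y}))^{\perp}$ has discrete spectrum. 2. For every $n\in\mathbb{Z}\setminus\{0\}$ the subspace $L^2_n$ reduces $\underline{\Delta}_{\mathbb{Y}}$, the restriction of $\underline{\Delta}_{\mathbb{Y}}$ to $L^2_n$ has discrete spectrum, and the spectrum of the restriction of $-\underline{\Delta}_{\mathbb{Y}}$ to $L^2_n$ is contained in $[4\pi^2n^2,\infty)$. -/

import Mathlib

open MeasureTheory Set
open scoped ContDiff

noncomputable section

namespace Cusp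

/-! ### Unbounded operators in a Hilbert space: restriction, spectrum, discreteness -/

section Operators

variable {H : Type*} [NormedAddCommGroup H] [InnerProductSpace ℂ H]

/-- `K` reduces `T`: if `u = v + w` with `u` in the domain of `T`, `v ∈ K` and `w ∈ Kᗮ`, then
`v` and `w` lie in the domain, `T v ∈ K` and `T w ∈ Kᗮ`. -/
def Reduces (T : H →ₗ.[ℂ] H) (K : Submodule ℂ H) : Prop :=
  ∀ v ∈ K, ∀ w ∈ Kᗮ, v + w ∈ T.domain →
    (∃ hv : v ∈ T.domain, T ⟨v, hv⟩ ∈ K) ∧ (∃ hw : w ∈ T.domain, T ⟨w, hw⟩ ∈ Kᗮ)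

/-- The domain of the restriction of `T` to `K`: those `u ∈ K` in the domain of `T` that `T` maps
into `K` (when `K` reduces `T`, all `u ∈ K` in the domain of `T`). -/
def restrictDomain (T : H →ₗ.[ℂ] H) (K : Submodule ℂ H) : Submodule ℂ K where
  carrier := {u | ∃ h : (u : H) ∈ T.domain, T ⟨u, h⟩ ∈ K}
  zero_mem' := ⟨T.domain.zero_mem, by
    have : T ⟨((0 : K) : H), T.domain.zero_mem⟩ = 0 := T.map_zero
    rw [this]; exact K.zero_mem⟩
  add_mem' := by
    rintro u v ⟨hu, hu'⟩ ⟨hv, hv'⟩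
    refine ⟨T.domain.add_mem hu hv, ?_⟩
    have : T ⟨((u + v : K) : H), T.domain.add_mem hu hv⟩ = T ⟨u, hu⟩ + T ⟨v, hv⟩ :=
      T.map_add ⟨u, hu⟩ ⟨v, hv⟩
    rw [this]; exact K.add_mem hu' hv'
  smul_mem' := by
    rintro c u ⟨hu, hu'⟩
    refine ⟨T.domain.smul_mem c hu, ?_⟩
    have : T ⟨((c • u : K) : H), T.domain.smul_mem c hu⟩ = c • T ⟨u, hu⟩ :=
      T.map_smul c ⟨u, hu⟩
    rw [this]; exact K.smul_mem c hu'

/-- The restriction of an unbounded operator `T` in `H` to the subspace `K`, as an unbounded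
operator in `K`. -/
def restrict (T : H →ₗ.[ℂ] H) (K : Submodule ℂ H) : K →ₗ.[ℂ] K where
  domain := restrictDomain T K
  toFun :=
    { toFun := fun u => ⟨T ⟨((u : K) : H), u.2.1⟩, u.2.2⟩
      map_add' := fun u v =>
        Subtype.ext (T.map_add ⟨((u : K) : H), u.2.1⟩ ⟨((v : K) : H), v.2.1⟩)
      map_smul' := fun c u => Subtype.ext (T.map_smul c ⟨((u : K) : H), u.2.1⟩) }

/-- The resolvent set: those `z` for which `T - z` is a bijection from the domain of `T` onto the
whole space with a bounded inverse `R`. -/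
def resolventSet (T : H →ₗ.[ℂ] H) : Set ℂ :=
  {z | ∃ R : H →L[ℂ] H,
    (∀ f : H, ∃ h : R f ∈ T.domain, T ⟨R f, h⟩ - z • R f = f) ∧
    (∀ u : T.domain, R (T u - z • (u : H)) = u)}

/-- The spectrum of an unbounded operator. -/
def spectrum (T : H →ₗ.[ℂ] H) : Set ℂ := (resolventSet T)ᶜ

/-- The eigenspace `{u ∈ dom T | T u = z u}`. -/
def eigenspace (T : H →ₗ.[ℂ] H) (z : ℂ) : Submodule ℂ T.domain :=
  LinearMap.ker (T.toFun - z • T.domain.subtype)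

/-- `T` has discrete spectrum: each point of the spectrum is an isolated point of the spectrum and
an eigenvalue of finite multiplicity. -/
def HasDiscreteSpectrum (T : H →ₗ.[ℂ] H) : Prop :=
  ∀ z ∈ spectrum T,
    (∃ ε > 0, ∀ w ∈ spectrum T, ‖w - z‖ < ε → w = z) ∧
    eigenspace T z ≠ ⊥ ∧ FiniteDimensional ℂ (eigenspace T z)

end Operators

/-! ### The cusp and its `L²` space -/

/-- The measure `(1 + x/a)^(-a) dx` on `[1, ∞)`. -/
def radialMeasure (a : ℝ) : Measure ℝ :=
  (volume.restrict (Ici 1)).withDensity fun x => ENNReal.ofReal ((1 + x / a) ^ (-a))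

/-- The Riemannian measure `(1 + x/a)^(-a) dx dy` on `[1, ∞) × S¹`, where `S¹ = ℝ / ℤ`. -/
def cuspMeasure (a : ℝ) : Measure (ℝ × UnitAddCircle) :=
  (radialMeasure a).prod volume

/-- The Hilbert space `L²` of the cusp. -/
abbrev L2 (a : ℝ) : Type := Lp ℂ 2 (cuspMeasure a)

/-- The `n`-th Fourier mode: all `u ∈ L²` of the form `u(x, y) = v(x) e^{2π i n y}` with `v` in
`L²([1, ∞), (1 + x/a)^(-a) dx)`. -/
def modeSubspace (a : ℝ) (n : ℤ) : Submodule ℂ (L2 a) where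
  carrier := {u | ∃ v : ℝ → ℂ, MemLp v 2 (radialMeasure a) ∧
    (u : ℝ × UnitAddCircle → ℂ) =ᵐ[cuspMeasure a] fun p => v p.1 * fourier n p.2}
  zero_mem' := ⟨0, MemLp.zero, by
    filter_upwards [Lp.coeFn_zero ℂ 2 (cuspMeasure a)] with p hp
    exact hp.trans (by simp)⟩
  add_mem' := by
    rintro u u' ⟨v, hv, h⟩ ⟨v', hv', h'⟩
    refine ⟨v + v', hv.add hv', ?_⟩
    filter_upwards [Lp.coeFn_add u u', h, h'] with p h1 h2 h3
    simp only [h1, Pi.add_apply, h2, h3]; ring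
  smul_mem' := by
    rintro c u ⟨v, hv, h⟩
    refine ⟨c • v, hv.const_smul c, ?_⟩
    filter_upwards [Lp.coeFn_smul c u, h] with p h1 h2
    simp only [h1, Pi.smul_apply, h2, smul_eq_mul]; ring

/-- The harmonic components, that is, the zero Fourier mode. -/
abbrev harmonic (a : ℝ) : Submodule ℂ (L2 a) := modeSubspace a 0

/-! ### Test functions -/

/-- A function on `ℝ × S¹` seen as a function on `ℝ × ℝ` that is periodic in the second variable. -/
def lift (φ : ℝ × UnitAddCircle → ℂ) (p : ℝ × ℝ) : ℂ := φ (p.1, (p.2 : UnitAddCircle))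

/-- Smooth functions with compact support in `(1, ∞) × S¹`. -/
def testFunctions : Submodule ℂ (ℝ × UnitAddCircle → ℂ) where
  carrier := {φ | ContDiff ℝ ∞ (lift φ) ∧ HasCompactSupport φ ∧ tsupport φ ⊆ Ioi 1 ×ˢ univ}
  zero_mem' := ⟨contDiff_const, HasCompactSupport.zero, by simp [tsupport]⟩
  add_mem' := by
    rintro φ ψ ⟨h1, h2, h3⟩ ⟨k1, k2, k3⟩
    exact ⟨h1.add k1, h2.add k2, (tsupport_add φ ψ).trans (union_subset h3 k3)⟩
  smul_mem' := by
    rintro c φ ⟨h1, h2, h3⟩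
    exact ⟨h1.const_smul c, h2.smul_left (f := fun _ => c),
      (tsupport_smul_subset_right (fun _ => c) φ).trans h3⟩

/-- `∂φ/∂x`. -/
def partialX (φ : ℝ × UnitAddCircle → ℂ) (p : ℝ × UnitAddCircle) : ℂ :=
  deriv (fun s : ℝ => φ (s, p.2)) p.1

/-- `∂φ/∂y`. -/
def partialY (φ : ℝ × UnitAddCircle → ℂ) (p : ℝ × UnitAddCircle) : ℂ :=
  deriv (fun s : ℝ => φ (p.1, p.2 + (s : UnitAddCircle))) 0

lemma differentiableAt_x {φ : ℝ × UnitAddCircle → ℂ} (h : ContDiff ℝ ∞ (lift φ))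
    (p : ℝ × UnitAddCircle) : DifferentiableAt ℝ (fun s : ℝ => φ (s, p.2)) p.1 := by
  obtain ⟨x, y⟩ := p
  obtain ⟨y, rfl⟩ := QuotientAddGroup.mk_surjective y
  have : ContDiff ℝ ∞ (fun s : ℝ => lift φ (s, y)) := h.comp (by fun_prop)
  exact (this.differentiable (by simp)).differentiableAt

lemma differentiableAt_y {φ : ℝ × UnitAddCircle → ℂ} (h : ContDiff ℝ ∞ (lift φ))
    (p : ℝ × UnitAddCircle) :
    DifferentiableAt ℝ (fun s : ℝ => φ (p.1, p.2 + (s : UnitAddCircle))) 0 := by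
  obtain ⟨x, y⟩ := p
  obtain ⟨y, rfl⟩ := QuotientAddGroup.mk_surjective y
  have : ContDiff ℝ ∞ (fun s : ℝ => lift φ (x, y + s)) := h.comp (by fun_prop)
  exact (this.differentiable (by simp)).differentiableAt

lemma lift_partialX {φ : ℝ × UnitAddCircle → ℂ} (h : ContDiff ℝ ∞ (lift φ)) :
    lift (partialX φ) = fun p => fderiv ℝ (lift φ) p (1, 0) := by
  funext p
  have hd : HasFDerivAt (lift φ) (fderiv ℝ (lift φ) p) (p.1, p.2) :=
    (h.differentiable (by simp)).differentiableAt.hasFDerivAt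
  have hc : HasDerivAt (fun s : ℝ => (s, p.2)) ((1 : ℝ), (0 : ℝ)) p.1 :=
    (hasDerivAt_id p.1).prodMk (hasDerivAt_const p.1 p.2)
  exact (hd.comp_hasDerivAt p.1 hc).deriv

lemma lift_partialY {φ : ℝ × UnitAddCircle → ℂ} (h : ContDiff ℝ ∞ (lift φ)) :
    lift (partialY φ) = fun p => fderiv ℝ (lift φ) p (0, 1) := by
  funext p
  have hd : HasFDerivAt (lift φ) (fderiv ℝ (lift φ) p) (p.1, p.2 + 0) := by
    rw [add_zero]
    exact (h.differentiable (by simp)).differentiableAt.hasFDerivAt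
  have hc : HasDerivAt (fun s : ℝ => (p.1, p.2 + s)) ((0 : ℝ), (1 : ℝ)) 0 :=
    (hasDerivAt_const (0 : ℝ) p.1).prodMk ((hasDerivAt_id (0 : ℝ)).const_add p.2)
  exact (hd.comp_hasDerivAt 0 hc).deriv

lemma contDiff_fderiv_apply {f : ℝ × ℝ → ℂ} (h : ContDiff ℝ ∞ f) (v : ℝ × ℝ) :
    ContDiff ℝ ∞ fun p => fderiv ℝ f p v :=
  (h.fderiv_right (m := ∞) (by simp)).clm_apply contDiff_const

lemma mem_testFunctions_of_support {φ ψ : ℝ × UnitAddCircle → ℂ} (hφ : φ ∈ testFunctions)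
    (hψ : ContDiff ℝ ∞ (lift ψ)) (hs : Function.support ψ ⊆ tsupport φ) : ψ ∈ testFunctions :=
  ⟨hψ, hφ.2.1.mono' hs, (closure_minimal hs (isClosed_tsupport φ)).trans hφ.2.2⟩

lemma support_partialX (φ : ℝ × UnitAddCircle → ℂ) :
    Function.support (partialX φ) ⊆ tsupport φ := by
  intro p hp
  by_contra hn
  refine hp ?_
  have h0 := notMem_tsupport_iff_eventuallyEq.1 hn
  have hc : Filter.Tendsto (fun s : ℝ => (s, p.2)) (nhds p.1) (nhds p) :=
    (by fun_prop : Continuous fun s : ℝ => (s, p.2)).tendsto p.1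
  have h1 : (fun s : ℝ => φ (s, p.2)) =ᶠ[nhds p.1] fun _ => 0 := hc.eventually h0
  exact h1.deriv_eq.trans (by simp)

lemma support_partialY (φ : ℝ × UnitAddCircle → ℂ) :
    Function.support (partialY φ) ⊆ tsupport φ := by
  intro p hp
  by_contra hn
  refine hp ?_
  have h0 := notMem_tsupport_iff_eventuallyEq.1 hn
  have hc : Filter.Tendsto (fun s : ℝ => (p.1, p.2 + (s : UnitAddCircle))) (nhds 0) (nhds p) := by
    have hk : Continuous fun s : ℝ => (p.1, p.2 + (s : UnitAddCircle)) := by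
      have := AddCircle.continuous_mk' (1 : ℝ)
      exact continuous_const.prodMk (continuous_const.add this)
    simpa using hk.tendsto 0
  have h1 : (fun s : ℝ => φ (p.1, p.2 + (s : UnitAddCircle))) =ᶠ[nhds 0] fun _ => 0 :=
    hc.eventually h0
  exact h1.deriv_eq.trans (by simp)

/-- `∂/∂x` on test functions. -/
def dX : testFunctions →ₗ[ℂ] testFunctions where
  toFun φ := ⟨partialX φ, mem_testFunctions_of_support φ.2
    (by rw [lift_partialX φ.2.1]; exact contDiff_fderiv_apply φ.2.1 _) (support_partialX φ)⟩
  map_add' φ ψ := Subtype.ext <| funext fun p =>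
    deriv_fun_add (differentiableAt_x φ.2.1 p) (differentiableAt_x ψ.2.1 p)
  map_smul' c φ := Subtype.ext <| funext fun p =>
    deriv_fun_const_smul c (differentiableAt_x φ.2.1 p)

/-- `∂/∂y` on test functions. -/
def dY : testFunctions →ₗ[ℂ] testFunctions where
  toFun φ := ⟨partialY φ, mem_testFunctions_of_support φ.2
    (by rw [lift_partialY φ.2.1]; exact contDiff_fderiv_apply φ.2.1 _) (support_partialY φ)⟩
  map_add' φ ψ := Subtype.ext <| funext fun p =>
    deriv_fun_add (differentiableAt_y φ.2.1 p) (differentiableAt_y ψ.2.1 p)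
  map_smul' c φ := Subtype.ext <| funext fun p =>
    deriv_fun_const_smul c (differentiableAt_y φ.2.1 p)

lemma contDiff_mul {g : ℝ → ℝ} (hg : ContDiffOn ℝ ∞ g (Ioi 1)) {φ : ℝ × UnitAddCircle → ℂ}
    (hφ : φ ∈ testFunctions) :
    ContDiff ℝ ∞ (lift fun p => (g p.1 : ℂ) * φ p) := by
  rw [contDiff_iff_contDiffAt]
  intro p
  by_cases hp : (p.1, (p.2 : UnitAddCircle)) ∈ tsupport φ
  · have h1 : p.1 ∈ Ioi (1 : ℝ) := (hφ.2.2 hp).1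
    have h2 : ContDiffAt ℝ ∞ (fun q : ℝ × ℝ => g q.1) p :=
      (hg.contDiffAt (Ioi_mem_nhds h1)).comp p contDiffAt_fst
    exact (Complex.ofRealCLM.contDiff.contDiffAt.comp p h2).mul hφ.1.contDiffAt
  · have h0 := notMem_tsupport_iff_eventuallyEq.1 hp
    have hk : Continuous fun q : ℝ × ℝ => (q.1, (q.2 : UnitAddCircle)) :=
      continuous_fst.prodMk ((AddCircle.continuous_mk' (1 : ℝ)).comp continuous_snd)
    have h1 := (hk.tendsto p).eventually h0
    refine (contDiffAt_const (c := (0 : ℂ))).congr_of_eventuallyEq ?_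
    filter_upwards [h1] with q hq
    simp only [lift]
    rw [hq]; simp

/-- Multiplication of test functions by a function of `x` that is smooth on `(1, ∞)`. -/
def mulX (g : ℝ → ℝ) (hg : ContDiffOn ℝ ∞ g (Ioi 1)) : testFunctions →ₗ[ℂ] testFunctions where
  toFun φ := ⟨fun p => (g p.1 : ℂ) * φ.1 p, mem_testFunctions_of_support φ.2
    (contDiff_mul hg φ.2) fun _ hp => subset_tsupport φ.1 (right_ne_zero_of_mul hp)⟩
  map_add' φ ψ := Subtype.ext <| funext fun p => mul_add (g p.1 : ℂ) (φ.1 p) (ψ.1 p)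
  map_smul' c φ := Subtype.ext <| funext fun p => mul_left_comm (g p.1 : ℂ) c (φ.1 p)

lemma base_pos {a x : ℝ} (ha : 0 < a) (hx : x ∈ Ioi (1 : ℝ)) : 0 < 1 + x / a := by
  have : 0 < x := lt_trans one_pos hx
  positivity

lemma contDiffOn_rpow {a : ℝ} (ha : 0 < a) (r : ℝ) :
    ContDiffOn ℝ ∞ (fun x : ℝ => (1 + x / a) ^ r) (Ioi 1) :=
  ContDiffOn.rpow_const_of_ne (by fun_prop) fun _ hx => (base_pos ha hx).ne'

lemma contDiffOn_inv {a : ℝ} (ha : 0 < a) :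
    ContDiffOn ℝ ∞ (fun x : ℝ => 1 / (1 + x / a)) (Ioi 1) :=
  contDiffOn_const.div (by fun_prop) fun _ hx => (base_pos ha hx).ne'

/-- The Laplacian `∂²/∂x² - (1 + x/a)⁻¹ ∂/∂x + (1 + x/a)^(2a) ∂²/∂y²` on test functions. -/
def laplacian {a : ℝ} (ha : 0 < a) : testFunctions →ₗ[ℂ] testFunctions :=
  dX ∘ₗ dX - mulX (fun x => 1 / (1 + x / a)) (contDiffOn_inv ha) ∘ₗ dX
    + mulX (fun x => (1 + x / a) ^ (2 * a)) (contDiffOn_rpow ha (2 * a)) ∘ₗ dY ∘ₗ dY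

/-! ### The Dirichlet Laplacian -/

lemma radialMeasure_le {a : ℝ} (ha : 0 < a) : radialMeasure a ≤ volume := by
  have h : radialMeasure a ≤ (volume.restrict (Ici 1)).withDensity 1 := by
    refine withDensity_mono ?_
    filter_upwards [ae_restrict_mem measurableSet_Ici] with x hx
    have hx' : (1 : ℝ) ≤ x := hx
    have h1 : 1 ≤ 1 + x / a := le_add_of_nonneg_right (by positivity)
    simpa using Real.rpow_le_one_of_one_le_of_nonpos h1 (by linarith)
  rw [withDensity_one] at h
  exact h.trans Measure.restrict_le_self

instance (a : ℝ) : SFinite (radialMeasure a) := by unfold radialMeasure; infer_instance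

lemma isFiniteMeasureOnCompacts {a : ℝ} (ha : 0 < a) :
    IsFiniteMeasureOnCompacts (cuspMeasure a) := by
  refine ⟨fun K hK => ?_⟩
  have hle : cuspMeasure a ≤ (volume : Measure ℝ).prod (volume : Measure UnitAddCircle) :=
    Measure.prod_mono (radialMeasure_le ha) le_rfl
  exact (hle K).trans_lt hK.measure_lt_top

lemma continuous_of_mem {φ : ℝ × UnitAddCircle → ℂ} (hφ : φ ∈ testFunctions) :
    Continuous φ := by
  have hq : Topology.IsQuotientMap
      (Prod.map (id : ℝ → ℝ) (fun y : ℝ => (y : UnitAddCircle))) := by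
    refine IsOpenMap.isQuotientMap ?_ ?_ ?_
    · exact IsOpenMap.id.prodMap QuotientAddGroup.isOpenMap_coe
    · exact continuous_id.prodMap (AddCircle.continuous_mk' (1 : ℝ))
    · exact Function.surjective_id.prodMap QuotientAddGroup.mk_surjective
  exact hq.continuous_iff.2 hφ.1.continuous

lemma memLp_of_mem {a : ℝ} (ha : 0 < a) {φ : ℝ × UnitAddCircle → ℂ} (hφ : φ ∈ testFunctions) :
    MemLp φ 2 (cuspMeasure a) :=
  haveI := isFiniteMeasureOnCompacts ha
  (continuous_of_mem hφ).memLp_of_hasCompactSupport hφ.2.1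

/-- The inclusion of the test functions into `L²`. -/
def toL2 {a : ℝ} (ha : 0 < a) : testFunctions →ₗ[ℂ] L2 a where
  toFun φ := (memLp_of_mem ha φ.2).toLp
  map_add' φ ψ := MemLp.toLp_add (memLp_of_mem ha φ.2) (memLp_of_mem ha ψ.2)
  map_smul' c φ := MemLp.toLp_const_smul c (memLp_of_mem ha φ.2)

lemma toL2_injective {a : ℝ} (ha : 0 < a) : Function.Injective (toL2 ha) := by
  intro φ ψ h
  have h1 : φ.1 =ᵐ[cuspMeasure a] ψ.1 := 
    (MemLp.toLp_eq_toLp_iff (memLp_of_mem ha φ.2) (memLp_of_mem ha ψ.2)).1 h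
  have hac : (volume.restrict (Ici (1 : ℝ))) ≪ radialMeasure a := by
    refine withDensity_absolutelyContinuous' (by fun_prop) ?_
    filter_upwards [ae_restrict_mem measurableSet_Ici] with x hx
    have hx' : (1 : ℝ) ≤ x := hx
    have : 0 < 1 + x / a := by positivity
    simpa using Real.rpow_pos_of_pos this (-a)
  have h2 : φ.1 =ᵐ[(volume.restrict (Ici (1 : ℝ))).prod (volume : Measure UnitAddCircle)] ψ.1 :=
    (hac.prod Measure.AbsolutelyContinuous.rfl).ae_eq h1
  have h3 : φ.1 =ᵐ[((volume : Measure ℝ).prod (volume : Measure UnitAddCircle)).restrict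
      (Ioi 1 ×ˢ univ)] ψ.1 := by
    rw [← Measure.restrict_univ (μ := (volume : Measure UnitAddCircle)),
      Measure.prod_restrict] at h2
    exact ae_restrict_of_ae_restrict_of_subset
      (prod_mono Ioi_subset_Ici_self subset_rfl) h2
  have h4 := Measure.eqOn_open_of_ae_eq h3 (isOpen_Ioi.prod isOpen_univ)
    (continuous_of_mem φ.2).continuousOn (continuous_of_mem ψ.2).continuousOn
  refine Subtype.ext (funext fun p => ?_)
  by_cases hp : p ∈ Ioi (1 : ℝ) ×ˢ (univ : Set UnitAddCircle)
  · exact h4 hp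
  · rw [image_eq_zero_of_notMem_tsupport fun h => hp (φ.2.2.2 h),
      image_eq_zero_of_notMem_tsupport fun h => hp (ψ.2.2.2 h)]

/-- The Laplacian on the test functions, as an unbounded operator in `L²`. -/
def minimalLaplacian {a : ℝ} (ha : 0 < a) : L2 a →ₗ.[ℂ] L2 a where
  domain := LinearMap.range (toL2 ha)
  toFun := toL2 ha ∘ₗ laplacian ha ∘ₗ
    (LinearEquiv.ofInjective (toL2 ha) (toL2_injective ha)).symm.toLinearMap

/-- The map `φ ↦ (φ, ∂φ/∂x, (1 + x/a)^a ∂φ/∂y)` into `L² × L² × L²`; the last two components are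
those of the Riemannian gradient in an orthonormal frame. -/
def withGradient {a : ℝ} (ha : 0 < a) : testFunctions →ₗ[ℂ] L2 a × L2 a × L2 a :=
  (toL2 ha).prod ((toL2 ha ∘ₗ dX).prod
    (toL2 ha ∘ₗ mulX (fun x => (1 + x / a) ^ a) (contDiffOn_rpow ha a) ∘ₗ dY))

/-- The Sobolev space `H¹₀`, the form domain: all `u ∈ L²` that are `L²` limits of test functions
whose gradients converge in `L²` as well. -/
def H10 {a : ℝ} (ha : 0 < a) : Submodule ℂ (L2 a) :=
  (LinearMap.range (withGradient ha)).topologicalClosure.map (LinearMap.fst ℂ _ _)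

/-- The Dirichlet Laplacian, that is, the Friedrichs extension of the Laplacian on test functions:
the restriction to `H¹₀` of the adjoint, so that its domain consists of all `u ∈ H¹₀` whose
distributional Laplacian lies in `L²`. -/
def dirichletLaplacian {a : ℝ} (ha : 0 < a) : L2 a →ₗ.[ℂ] L2 a :=
  (LinearPMap.adjoint (minimalLaplacian ha)).domRestrict (H10 ha)

end Cusp

end

/-! Everything is read off from the resolvent R = (1 - Δ)⁻¹ of the Dirichlet Laplacian. Let J be the
inclusion of the form domain H¹₀, with its Hilbert norm ‖u‖² + ‖∇u‖², into L². Then R = J J*: by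
Green's formula (`inner_gradient`), u = J J* f is the unique weak solution in H¹₀ of u - Δu = f, and
this is what it means to invert 1 - Δ on the domain of the Friedrichs extension
(`isResolventAtOne_formResolvent`). In particular R is bounded and symmetric.

The coefficients of Δ depend on x alone, so Δ commutes with the Fourier projections in y, and so
does R (`formResolvent_commute`). Hence R preserves every mode and its orthogonal complement, which
gives the reductions.

Away from the zero mode R is compact (`exists_norm_sub_project_sq_le`). The form contains (1 +
x/a)^(2a) ‖∂_y u‖² on each circle. For zero-mean u this controls the part of u over x > X with the
factor (1 + X/a)^(-2a), and the modes |n| > k with the factor k⁻². What remains are finitely many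
modes on [1, X], where a Poincaré inequality on a fine grid leaves an arbitrarily small multiple of
the form and finitely many linear functionals. An operator with such estimates is a norm limit of
finite rank operators. No such gain exists for n = 0, where the y-derivative vanishes.

The Fredholm alternative and the map z ↦ (1 - z)⁻¹ carry the spectral theory of compact symmetric
operators over to Δ (`IsResolventAtOne.hasDiscreteSpectrum`). On the n-th mode the form is at least
(1 + 4π²n²)‖u‖², so the eigenvalues of R there are at most 1/(1 + 4π²n²), which is the lower bound
for -Δ. -/

open scoped ComplexConjugate

namespace Cusp

/-! ### Discrete spectrum from a compact symmetric resolvent -/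

section Resolvent

variable {K : Type*} [NormedAddCommGroup K] [InnerProductSpace ℂ K]

/-- `R` is the inverse of `1 - A`. -/
structure IsResolventAtOne (A : K →ₗ.[ℂ] K) (R : K →L[ℂ] K) : Prop where
  right_inv : ∀ f : K, ∃ h : R f ∈ A.domain, A ⟨R f, h⟩ = R f - f
  left_inv : ∀ u : A.domain, R ((u : K) - A u) = u

lemma IsResolventAtOne.one_notMem_spectrum {A : K →ₗ.[ℂ] K} {R : K →L[ℂ] K}
    (hR : IsResolventAtOne A R) : (1 : ℂ) ∉ spectrum A := by
  refine fun h => h ⟨-R, fun f => ?_, fun u => ?_⟩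
  · obtain ⟨h, hA⟩ := hR.right_inv (-f)
    have e : (-R) f = R (-f) := by simp
    -- The proof of domain membership depends on the vector, so the equality is used by substitution
    -- instead of rewriting.
    have key : ∀ v : K, v = R (-f) → ∃ h : v ∈ A.domain, A ⟨v, h⟩ - (1 : ℂ) • v = f := by
      rintro v rfl
      exact ⟨h, by rw [hA]; simp⟩
    exact key _ e
  · have := hR.left_inv u
    rw [← this, neg_apply, ← map_neg]
    congr 1
    rw [this]; simp

lemma IsResolventAtOne.mem_eigenspace {A : K →ₗ.[ℂ] K} {R : K →L[ℂ] K}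
    (hR : IsResolventAtOne A R) {z : ℂ} (hz : z ≠ 1) {u : A.domain} (hu : A u = z • (u : K)) :
    R u = (1 - z)⁻¹ • (u : K) := by
  have h1 := hR.left_inv u
  have hz' : 1 - z ≠ 0 := sub_ne_zero.2 hz.symm
  rw [hu] at h1
  have : (u : K) - z • (u : K) = (1 - z) • (u : K) := by rw [sub_smul, one_smul]
  rw [this, map_smul] at h1
  rw [eq_inv_smul_iff₀ hz', h1]

lemma IsResolventAtOne.apply_eq {A : K →ₗ.[ℂ] K} {R : K →L[ℂ] K}
    (hR : IsResolventAtOne A R) {z : ℂ} (hz : z ≠ 1) {x : K} (hx : R x = (1 - z)⁻¹ • x) :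
    ∃ h : x ∈ A.domain, A ⟨x, h⟩ = z • x := by
  have hz' : 1 - z ≠ 0 := sub_ne_zero.2 hz.symm
  obtain ⟨h, hA⟩ := hR.right_inv ((1 - z) • x)
  have e : R ((1 - z) • x) = x := by rw [map_smul, hx, smul_inv_smul₀ hz']
  have key : ∀ v w : K, ∀ h : v ∈ A.domain, A ⟨v, h⟩ = v - (1 - z) • w → v = w →
      ∃ h : w ∈ A.domain, A ⟨w, h⟩ = z • w := by
    rintro v w h hA rfl
    exact ⟨h, by rw [hA, sub_smul, one_smul, sub_sub_cancel]⟩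
  exact key _ _ h hA e

/-- Fredholm alternative at μ = (1 - z)⁻¹ ≠ 0: if μ is not an eigenvalue of R, then μ - R is
invertible, and an inverse of A - z can be written down. -/
lemma IsResolventAtOne.hasEigenvalue_of_mem_spectrum [CompleteSpace K] {A : K →ₗ.[ℂ] K}
    {R : K →L[ℂ] K} (hR : IsResolventAtOne A R) (hc : IsCompactOperator R) {z : ℂ}
    (hz : z ∈ spectrum A) : z ≠ 1 ∧ Module.End.HasEigenvalue (R : Module.End ℂ K) (1 - z)⁻¹ := by
  have hz1 : z ≠ 1 := by
    rintro rfl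
    exact hR.one_notMem_spectrum hz
  have hz' : 1 - z ≠ 0 := sub_ne_zero.2 hz1.symm
  refine ⟨hz1, (hc.hasEigenvalue_or_mem_resolventSet (inv_ne_zero hz')).resolve_right fun hμ => ?_⟩
  refine hz ?_
  rw [_root_.spectrum.mem_resolventSet_iff] at hμ
  obtain ⟨U, hU⟩ := hμ
  set μ : ℂ := (1 - z)⁻¹ with hμd
  set S : K →L[ℂ] K := (↑U⁻¹ : K →L[ℂ] K) with hS
  have hUa : ∀ x, (U : K →L[ℂ] K) x = μ • x - R x := by
    intro x; rw [hU]; simp [Algebra.algebraMap_eq_smul_one]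
  have hUS : ∀ x, μ • S x - R (S x) = x := by
    intro x
    rw [← hUa, hS, ← mul_apply_eq_comp, Units.mul_inv]; rfl
  have hSU : ∀ x, S (μ • x - R x) = x := by
    intro x
    rw [← hUa, hS, ← mul_apply_eq_comp, Units.inv_mul]; rfl
  have hμz : (1 - z) * μ = 1 := mul_inv_cancel₀ hz'
  -- With g = (1 - A)u and u = R g one has (A - z)u = -(1 - z)(μ - R)g, so u is recovered by
  -- applying -μ S and then R.
  refine ⟨R ∘L (-(μ • S)), fun f => ?_, fun u => ?_⟩
  · obtain ⟨h, hA⟩ := hR.right_inv ((-(μ • S)) f)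
    refine ⟨h, ?_⟩
    change A ⟨R ((-(μ • S)) f), h⟩ - z • R ((-(μ • S)) f) = f
    rw [hA]
    have e : (-(μ • S)) f = -(μ • S f) := by simp
    rw [e, map_neg, map_smul]
    have h1 := hUS f
    have h2 : -(μ • R (S f)) - -(μ • S f) - z • -(μ • R (S f))
        = μ • S f - ((1 - z) * μ) • R (S f) := by module
    rw [h2, hμz, one_smul, h1]
  · set g : K := (u : K) - A u with hg
    have hRg : R g = u := hR.left_inv u
    have h1 : A u - z • (u : K) = -(1 - z) • (μ • g - R g) := by
      have h3 : -(1 - z) • (μ • g - R g) = (1 - z) • R g - ((1 - z) * μ) • g := by module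
      rw [h3, hμz, one_smul, hRg, hg]; module
    have h4 : (-(μ • S)) (A u - z • (u : K)) = g := by
      rw [h1, map_smul]
      have h5 : (-(μ • S)) (μ • g - R g) = -(μ • g) := by
        rw [neg_apply, smul_apply, hSU]
      have h6 : -(1 - z) • -(μ • g) = ((1 - z) * μ) • g := by module
      rw [h5, h6, hμz, one_smul]
    rw [ContinuousLinearMap.comp_apply, h4, hRg]

/-- On the orthogonal complement of the μ-eigenspace R is compact without eigenvalue μ, so μ lies in
the open resolvent set of this restriction. Eigenvectors for ν ≠ μ are orthogonal to the
μ-eigenspace, hence live in that complement. -/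
lemma exists_ball_forall_not_hasEigenvalue [CompleteSpace K] {R : K →L[ℂ] K}
    (hc : IsCompactOperator R) (hs : (R : K →ₗ[ℂ] K).IsSymmetric) {μ : ℂ} (hμ : μ ≠ 0) :
    ∃ ε > 0, ∀ ν : ℂ, ‖ν - μ‖ < ε → Module.End.HasEigenvalue (R : Module.End ℂ K) ν → ν = μ := by
  set N : Submodule ℂ K := (Module.End.eigenspace (R : Module.End ℂ K) μ)ᗮ with hN
  have hinv : ∀ v ∈ N, (R : K →ₗ[ℂ] K) v ∈ N := hs.invariant_orthogonalComplement_eigenspace μ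
  let R' : N →L[ℂ] N := (R ∘L N.subtypeL).codRestrict N fun v => hinv v v.2
  have hc' : IsCompactOperator R' :=
    (hc.comp_clm N.subtypeL).codRestrict (fun v => hinv v v.2)
      (Submodule.isClosed_orthogonal _)
  have hno : ¬ Module.End.HasEigenvalue (R' : Module.End ℂ N) μ := by
    intro h
    obtain ⟨x, hx⟩ := h.exists_hasEigenvector
    have h1 : R (x : K) = μ • (x : K) := congrArg Subtype.val hx.apply_eq_smul
    have h2 : (x : K) ∈ Module.End.eigenspace (R : Module.End ℂ K) μ :=
      Module.End.mem_eigenspace_iff.2 h1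
    have h3 : inner ℂ (x : K) (x : K) = 0 := x.2 _ h2
    exact hx.2 (Subtype.ext (inner_self_eq_zero.1 h3))
  have hres := (hc'.hasEigenvalue_or_mem_resolventSet hμ).resolve_left hno
  obtain ⟨ε, hε, hball⟩ := Metric.isOpen_iff.1 (_root_.spectrum.isOpen_resolventSet (𝕜 := ℂ) R') μ hres
  refine ⟨ε, hε, fun ν hν hev => ?_⟩
  by_contra hne
  obtain ⟨x, hx⟩ := hev.exists_hasEigenvector
  have hxN : x ∈ N := by
    intro y hy
    exact hs.orthogonalFamily_eigenspaces (Ne.symm hne) ⟨y, hy⟩ ⟨x, hx.1⟩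
  have hν' : ν ∈ _root_.resolventSet ℂ R' := hball (by simpa [dist_eq_norm] using hν)
  rw [_root_.spectrum.mem_resolventSet_iff] at hν'
  have hinj := (ContinuousLinearMap.isUnit_iff_bijective.1 hν').1
  have h0 : (algebraMap ℂ (N →L[ℂ] N) ν - R') ⟨x, hxN⟩ = 0 := by
    refine Subtype.ext ?_
    have : R x = ν • x := hx.apply_eq_smul
    change ν • x - R x = 0
    rw [this, sub_self]
  have := hinj (h0.trans (map_zero _).symm)
  exact hx.2 (congrArg Subtype.val this)

/-- The map z ↦ (1 - z)⁻¹ is injective, and continuous away from 1; it matches eigenspaces of A with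
eigenspaces of R for nonzero eigenvalues, so isolation and finite multiplicity transfer. -/
theorem IsResolventAtOne.hasDiscreteSpectrum [CompleteSpace K] {A : K →ₗ.[ℂ] K} {R : K →L[ℂ] K}
    (hR : IsResolventAtOne A R) (hc : IsCompactOperator R) (hs : (R : K →ₗ[ℂ] K).IsSymmetric) :
    HasDiscreteSpectrum A := by
  intro z hz
  obtain ⟨hz1, hev⟩ := hR.hasEigenvalue_of_mem_spectrum hc hz
  have hz' : 1 - z ≠ 0 := sub_ne_zero.2 hz1.symm
  refine ⟨?_, ?_, ?_⟩
  · obtain ⟨ε, hε, hb⟩ := exists_ball_forall_not_hasEigenvalue hc hs (inv_ne_zero hz')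
    have hcont : ContinuousAt (fun w : ℂ => (1 - w)⁻¹) z :=
      (continuousAt_const.sub continuousAt_id).inv₀ hz'
    obtain ⟨δ, hδ, hd⟩ := Metric.continuousAt_iff.1 hcont ε hε
    refine ⟨δ, hδ, fun w hw hwz => ?_⟩
    obtain ⟨hw1, hwe⟩ := hR.hasEigenvalue_of_mem_spectrum hc hw
    have := hb _ (by rw [← dist_eq_norm]; exact hd (by rwa [dist_eq_norm])) hwe
    have := inv_injective this
    linear_combination -this
  · obtain ⟨x, hx⟩ := hev.exists_hasEigenvector
    obtain ⟨h, hA⟩ := hR.apply_eq hz1 (x := x) hx.apply_eq_smul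
    refine (Submodule.ne_bot_iff _).2 ⟨⟨x, h⟩, ?_, fun h0 => hx.2 (congrArg Subtype.val h0)⟩
    refine LinearMap.mem_ker.2 ?_
    simpa [sub_eq_zero] using hA
  · have := ContinuousLinearMap.finite_dimensional_eigenspace hc _ (inv_ne_zero hz')
    have hmem : ∀ u : eigenspace A z, (u.1 : K) ∈
        Module.End.eigenspace (R : Module.End ℂ K) (1 - z)⁻¹ := by
      intro u
      have hu := u.2
      have hu : A u.1 - z • (u.1 : K) = 0 := LinearMap.mem_ker.1 hu
      exact Module.End.mem_eigenspace_iff.2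
        (hR.mem_eigenspace hz1 (sub_eq_zero.1 hu))
    refine FiniteDimensional.of_injective ((A.domain.subtype ∘ₗ (eigenspace A z).subtype).codRestrict
      (Module.End.eigenspace (R : Module.End ℂ K) (1 - z)⁻¹) hmem) fun u v huv => ?_
    have : (u.1 : K) = v.1 :=
      congrArg (fun w : Module.End.eigenspace (R : Module.End ℂ K) (1 - z)⁻¹ => (w : K)) huv
    exact Subtype.ext (Subtype.ext this)

lemma neg_mem_spectrum_of_mem_spectrum_neg {A : K →ₗ.[ℂ] K} {z : ℂ} (hz : z ∈ spectrum (-A)) :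
    -z ∈ spectrum A := by
  rintro ⟨R, h1, h2⟩
  refine hz ⟨-R, fun f => ?_, fun u => ?_⟩
  · obtain ⟨h, hA⟩ := h1 (-f)
    have key : ∀ v : K, v = R (-f) → ∃ h : v ∈ (-A).domain, (-A) ⟨v, h⟩ - z • v = f := by
      rintro v rfl
      refine ⟨h, ?_⟩
      rw [LinearPMap.neg_apply]
      linear_combination (norm := module) -hA
    exact key _ (by simp)
  · have := h2 u
    rw [← this, neg_apply, ← map_neg]
    congr 1
    rw [this, LinearPMap.neg_apply]
    module

end Resolvent

/-! ### Subspaces invariant under the resolvent -/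

section Reduction

variable {H : Type*} [NormedAddCommGroup H] [InnerProductSpace ℂ H]

/-- Split f = (1 - T)(v + w) along K ⊕ Kᗮ as f1 + f2. Then R f1 - v = w - R f2 lies in K ∩ Kᗮ, so v
= R f1 and w = R f2 are in the range of R. -/
lemma IsResolventAtOne.reduces {T : H →ₗ.[ℂ] H} {R : H →L[ℂ] H} (hR : IsResolventAtOne T R)
    {K : Submodule ℂ H} [K.HasOrthogonalProjection] (h1 : ∀ f ∈ K, R f ∈ K)
    (h2 : ∀ f ∈ Kᗮ, R f ∈ Kᗮ) : Reduces T K := by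
  intro v hv w hw hvw
  set f : H := (v + w) - T ⟨v + w, hvw⟩ with hf
  have hRf : R f = v + w := hR.left_inv ⟨v + w, hvw⟩
  obtain ⟨f1, hf1, f2, hf2, hff⟩ := K.exists_add_mem_mem_orthogonal f
  have hmem : R f1 - v ∈ K := K.sub_mem (h1 _ hf1) hv
  have hmem' : R f1 - v ∈ Kᗮ := by
    have : R f1 - v = w - R f2 := by
      rw [hff, map_add] at hRf
      linear_combination (norm := module) hRf
    rw [this]
    exact Kᗮ.sub_mem hw (h2 _ hf2)
  have e1 : R f1 - v = 0 := inner_self_eq_zero.1 (hmem' _ hmem)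
  have e1 : v = R f1 := (sub_eq_zero.1 e1).symm
  have e2 : w = R f2 := by
    rw [hff, map_add, ← e1] at hRf
    exact (add_left_cancel hRf).symm
  subst e1 e2
  obtain ⟨d1, a1⟩ := hR.right_inv f1
  obtain ⟨d2, a2⟩ := hR.right_inv f2
  exact ⟨⟨d1, by rw [a1]; exact K.sub_mem (h1 _ hf1) hf1⟩,
    ⟨d2, by rw [a2]; exact Kᗮ.sub_mem (h2 _ hf2) hf2⟩⟩

/-- The restriction of a bounded operator to an invariant subspace. -/
noncomputable def restrictCLM (R : H →L[ℂ] H) (K : Submodule ℂ H) (h : ∀ f ∈ K, R f ∈ K) : K →L[ℂ] K :=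
  (R ∘L K.subtypeL).codRestrict K fun f => h f f.2

lemma IsResolventAtOne.restrict {T : H →ₗ.[ℂ] H} {R : H →L[ℂ] H} (hR : IsResolventAtOne T R)
    {K : Submodule ℂ H} (h : ∀ f ∈ K, R f ∈ K) :
    IsResolventAtOne (restrict T K) (restrictCLM R K h) where
  right_inv f := by
    obtain ⟨d, a⟩ := hR.right_inv f
    have hm : T ⟨R f, d⟩ ∈ K := by
      rw [a]
      exact K.sub_mem (h _ f.2) f.2
    exact ⟨⟨d, hm⟩, Subtype.ext a⟩
  left_inv u := Subtype.ext (hR.left_inv ⟨u, u.2.1⟩)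

lemma isSymmetric_restrictCLM {R : H →L[ℂ] H} (hs : (R : H →ₗ[ℂ] H).IsSymmetric)
    (K : Submodule ℂ H) (h : ∀ f ∈ K, R f ∈ K) :
    (restrictCLM R K h : K →ₗ[ℂ] K).IsSymmetric := fun u v => hs u v

lemma mem_orthogonal_of_isSymmetric {R : H →L[ℂ] H} (hs : (R : H →ₗ[ℂ] H).IsSymmetric)
    {K : Submodule ℂ H} (h : ∀ f ∈ K, R f ∈ K) : ∀ f ∈ Kᗮ, R f ∈ Kᗮ := by
  intro f hf g hg
  have := hs g f
  simp only [ContinuousLinearMap.coe_coe] at this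
  rw [← this]
  exact hf _ (h _ hg)

end Reduction

/-! ### A compactness criterion -/

section Compact

variable {V F : Type*} [NormedAddCommGroup V] [InnerProductSpace ℂ V]
  [NormedAddCommGroup F] [InnerProductSpace ℂ F] [CompleteSpace F]

/-- An operator that is small on subspaces of finite codimension is compact. -/
lemma isCompactOperator_of_forall_exists_inner {B : V →L[ℂ] F}
    (h : ∀ ε > 0, ∃ (κ : Type) (_ : Fintype κ) (g : κ → V) (C : ℝ), ∀ v,
      ‖B v‖ ^ 2 ≤ ε * ‖v‖ ^ 2 + C * ∑ i, ‖inner ℂ (g i) v‖ ^ 2) : IsCompactOperator B := by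
  have hcl := isClosed_setOfPred_isCompactOperator (𝕜₁ := ℂ) (𝕜₂ := ℂ) (σ₁₂ := RingHom.id ℂ)
    (M₁ := V) (M₂ := F)
  have : B ∈ closure {f : V →L[ℂ] F | IsCompactOperator f} := by
    rw [Metric.mem_closure_iff]
    intro ε hε
    -- The square is there because the hypothesis bounds squared norms, the half because the
    -- distance has to be strictly below ε. On the complement of the span W of the `g i` the
    -- functionals vanish, so B differs from its composition with the projection onto W by at most ε
    -- / 2.
    obtain ⟨κ, _, g, C, hs⟩ := h ((ε / 2) ^ 2) (by positivity)
    let W : Submodule ℂ V := Submodule.span ℂ (range g)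
    have : FiniteDimensional ℂ W := FiniteDimensional.span_of_finite ℂ (finite_range g)
    refine ⟨B ∘L W.starProjection, ?_, ?_⟩
    · have h1 : IsCompactOperator (W.orthogonalProjectionOnto) := by
        refine ⟨Metric.closedBall 0 1, isCompact_closedBall _ _, ?_⟩
        exact W.orthogonalProjectionOnto.continuous.continuousAt.preimage_mem_nhds
          (by simpa using Metric.closedBall_mem_nhds (0 : W) one_pos)
      exact h1.clm_comp (B ∘L W.subtypeL)
    · rw [dist_eq_norm]
      refine lt_of_le_of_lt ?_ (half_lt_self hε)
      refine ContinuousLinearMap.opNorm_le_bound _ (by positivity) fun v => ?_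
      set w : V := v - W.starProjection v with hw
      have hwo : w ∈ Wᗮ := W.sub_starProjection_mem_orthogonal v
      have h0 : ∑ i, ‖inner ℂ (g i) w‖ ^ 2 = 0 := Finset.sum_eq_zero fun i _ => by
        rw [hwo _ (Submodule.subset_span (mem_range_self i))]; simp
      have h1 := hs w
      rw [h0, mul_zero, add_zero, ← mul_pow] at h1
      have h2 : ‖B w‖ ≤ ε / 2 * ‖w‖ := le_of_sq_le_sq h1 (by positivity)
      have h3 : ‖w‖ ≤ ‖v‖ := by
        have e : w = Wᗮ.starProjection v := by
          rw [hw, Submodule.starProjection_orthogonal]; rfl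
        rw [e]; exact Submodule.norm_starProjection_apply_le _ _
      have e : (B - B ∘L W.starProjection) v = B w := by simp [hw]
      rw [e]
      exact h2.trans (by gcongr)
  rw [hcl.closure_eq] at this
  exact this

end Compact

/-! ### The resolvent of a Friedrichs extension, abstractly -/

section Friedrichs

variable {H E D : Type*} [NormedAddCommGroup H] [InnerProductSpace ℂ H]
  [NormedAddCommGroup E] [InnerProductSpace ℂ E] [AddCommGroup D] [Module ℂ D]

/-- The form domain: the closure of the range of `j`. -/
abbrev formSpace (j : D →ₗ[ℂ] E) : Submodule ℂ E := (LinearMap.range j).topologicalClosure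

/-- The map from the form domain to the Hilbert space that is induced by `P`. -/
noncomputable def formMap (j : D →ₗ[ℂ] E) (P : E →L[ℂ] H) : formSpace j →L[ℂ] H := P ∘L (formSpace j).subtypeL

lemma formSpace_induction {j : D →ₗ[ℂ] E} {p : E → Prop} (hp : IsClosed {v | p v})
    (h : ∀ φ, p (j φ)) {v : E} (hv : v ∈ formSpace j) : p v := by
  have : closure (LinearMap.range j : Set E) ⊆ {v | p v} :=
    closure_minimal (by rintro _ ⟨φ, rfl⟩; exact h φ) hp
  exact this hv

/-- Only the first argument is extended by continuity: the second involves the unbounded `L` and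
stays a test function. -/
lemma inner_formSpace {j : D →ₗ[ℂ] E} {P : E →L[ℂ] H} {ι L : D →ₗ[ℂ] H}
    (hform : ∀ φ ψ, inner ℂ (j φ) (j ψ) = inner ℂ (P (j φ)) (ι ψ - L ψ))
    {v : E} (hv : v ∈ formSpace j) (ψ : D) : inner ℂ v (j ψ) = inner ℂ (P v) (ι ψ - L ψ) :=
  formSpace_induction (p := fun v => inner ℂ v (j ψ) = inner ℂ (P v) (ι ψ - L ψ))
    (isClosed_eq (by fun_prop) (by fun_prop)) (fun φ => hform φ ψ) hv

variable [CompleteSpace H] [CompleteSpace E]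

/-- The solution operator of the variational problem `⟪v, ψ⟫_E = ⟪f, P ψ⟫`. -/
noncomputable def formResolvent (j : D →ₗ[ℂ] E) (P : E →L[ℂ] H) : H →L[ℂ] H :=
  formMap j P ∘L (formMap j P).adjoint

lemma isSymmetric_formResolvent (j : D →ₗ[ℂ] E) (P : E →L[ℂ] H) :
    (formResolvent j P : H →ₗ[ℂ] H).IsSymmetric := by
  intro u v
  simp only [formResolvent, ContinuousLinearMap.coe_coe, ContinuousLinearMap.comp_apply]
  rw [← ContinuousLinearMap.adjoint_inner_left, ContinuousLinearMap.adjoint_inner_right]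

variable {j : D →ₗ[ℂ] E} {P : E →L[ℂ] H} {ι L : D →ₗ[ℂ] H}

/-- This is the weak form of (1 - L)u = f for u = J J* f: pairing J* f with `j ψ` in the form norm
gives the pairing of f with `ι ψ`. -/
lemma inner_formResolvent (hP : ∀ φ, P (j φ) = ι φ)
    (hform : ∀ φ ψ, inner ℂ (j φ) (j ψ) = inner ℂ (P (j φ)) (ι ψ - L ψ)) (f : H) (ψ : D) :
    inner ℂ (formResolvent j P f) (ι ψ - L ψ) = inner ℂ f (ι ψ) := by
  have h1 := inner_formSpace hform ((formMap j P).adjoint f).2 ψ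
  have hψ : j ψ ∈ formSpace j := Submodule.le_topologicalClosure _ ⟨ψ, rfl⟩
  have h2 := ContinuousLinearMap.adjoint_inner_left (formMap j P) ⟨j ψ, hψ⟩ f
  change inner ℂ (((formMap j P).adjoint f : formSpace j) : E) (j ψ) = inner ℂ f (P (j ψ)) at h2
  rw [hP] at h2
  rw [← h2, h1]
  rfl

/-- Uniqueness of weak solutions: a lift v of u to the form domain satisfies ⟪v, w⟫ = ⟪f, P w⟫ for w
in a dense set, hence for all w, which characterizes J* f. Any lift will do, so injectivity of `P`
on the form domain need not be proved separately. -/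
lemma eq_formResolvent (hP : ∀ φ, P (j φ) = ι φ)
    (hform : ∀ φ ψ, inner ℂ (j φ) (j ψ) = inner ℂ (P (j φ)) (ι ψ - L ψ)) {u f : H}
    (hu : u ∈ (formSpace j).map (P : E →ₗ[ℂ] H))
    (h : ∀ ψ, inner ℂ u (ι ψ - L ψ) = inner ℂ f (ι ψ)) : u = formResolvent j P f := by
  obtain ⟨v, hv, rfl⟩ := hu
  have key : ∀ w ∈ formSpace j, inner ℂ v w = inner ℂ f (P w) := fun w hw =>
    formSpace_induction (p := fun w => inner ℂ v w = inner ℂ f (P w))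
      (isClosed_eq (by fun_prop) (by fun_prop))
      (fun φ => by
        rw [inner_formSpace hform hv, hP]; exact h φ) hw
  have : (⟨v, hv⟩ : formSpace j) = (formMap j P).adjoint f := by
    refine ext_inner_right ℂ fun w => ?_
    rw [ContinuousLinearMap.adjoint_inner_left]
    exact key w w.2
  change formMap j P ⟨v, hv⟩ = _
  rw [this]; rfl

/-- The weak equation says that R f lies in the domain of the adjoint of `T₀`, with value R f - f;
uniqueness of weak solutions gives the left inverse. Density of the domain makes the adjoint well
defined. -/
theorem isResolventAtOne_formResolvent {T₀ : H →ₗ.[ℂ] H} (hd : Dense (T₀.domain : Set H))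
    (hdom : ∀ u, u ∈ T₀.domain ↔ ∃ φ, ι φ = u) (hT₀ : ∀ φ, T₀ ⟨ι φ, (hdom _).2 ⟨φ, rfl⟩⟩ = L φ)
    (hP : ∀ φ, P (j φ) = ι φ)
    (hform : ∀ φ ψ, inner ℂ (j φ) (j ψ) = inner ℂ (P (j φ)) (ι ψ - L ψ)) :
    IsResolventAtOne (T₀.adjoint.domRestrict ((formSpace j).map (P : E →ₗ[ℂ] H)))
      (formResolvent j P) where
  right_inv f := by
    have key : ∀ x : T₀.domain,
        inner ℂ (formResolvent j P f - f) (x : H) = inner ℂ (formResolvent j P f) (T₀ x) := by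
      rintro ⟨x, hx⟩
      obtain ⟨ψ, rfl⟩ := (hdom x).1 hx
      have := inner_formResolvent hP hform f ψ
      rw [inner_sub_right] at this
      rw [hT₀, inner_sub_left]
      linear_combination this
    have h1 : formResolvent j P f ∈ T₀.adjoint.domain :=
      LinearPMap.mem_adjoint_domain_of_exists _ ⟨_, key⟩
    have h2 : formResolvent j P f ∈ (formSpace j).map (P : E →ₗ[ℂ] H) :=
      ⟨_, ((formMap j P).adjoint f).2, rfl⟩
    exact ⟨⟨h2, h1⟩, LinearPMap.adjoint_apply_eq hd ⟨_, h1⟩ key⟩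
  left_inv u := by
    refine (eq_formResolvent hP hform u.2.1 fun ψ => ?_).symm
    have := LinearPMap.adjoint_isFormalAdjoint hd ⟨u, u.2.2⟩ ⟨ι ψ, (hdom _).2 ⟨ψ, rfl⟩⟩
    rw [hT₀] at this
    change inner ℂ (T₀.adjoint ⟨u, u.2.2⟩) (ι ψ) = inner ℂ (u : H) (L ψ) at this
    rw [inner_sub_right, inner_sub_left]
    change _ = _ - inner ℂ (T₀.adjoint ⟨u, u.2.2⟩) (ι ψ)
    rw [this]

/-- Since `Q` is symmetric and commutes with `ι` and `L`, the vector Q R f is a weak solution for Q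
f; the lift `Q'` keeps it in the form domain, and uniqueness applies. -/
lemma formResolvent_commute (hP : ∀ φ, P (j φ) = ι φ)
    (hform : ∀ φ ψ, inner ℂ (j φ) (j ψ) = inner ℂ (P (j φ)) (ι ψ - L ψ))
    {Q : H →L[ℂ] H} {Q' : E →L[ℂ] E} {S : D →ₗ[ℂ] D} (hQ : (Q : H →ₗ[ℂ] H).IsSymmetric)
    (hQ' : ∀ φ, Q' (j φ) = j (S φ)) (hPQ : ∀ v, P (Q' v) = Q (P v))
    (hι : ∀ φ, Q (ι φ) = ι (S φ)) (hL : ∀ φ, Q (L φ) = L (S φ)) (f : H) :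
    Q (formResolvent j P f) = formResolvent j P (Q f) := by
  refine eq_formResolvent hP hform ?_ fun ψ => ?_
  · have hmem : ∀ v ∈ formSpace j, Q' v ∈ formSpace j := fun v hv =>
      formSpace_induction (p := fun v => Q' v ∈ formSpace j)
        ((Submodule.isClosed_topologicalClosure _).preimage Q'.continuous)
        (fun φ => by
          rw [hQ']; exact Submodule.le_topologicalClosure _ ⟨_, rfl⟩) hv
    exact ⟨Q' ((formMap j P).adjoint f), hmem _ ((formMap j P).adjoint f).2, hPQ _⟩
  · have h1 := hQ (formResolvent j P f) (ι ψ - L ψ)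
    have h2 := hQ f (ι ψ)
    simp only [ContinuousLinearMap.coe_coe] at h1 h2
    rw [h1, h2, map_sub, hι, hL, inner_formResolvent hP hform]

/-- The estimate passes from test functions to the form domain, where it makes W J compact; then W R
= (W J) J*. -/
lemma isCompactOperator_comp_formResolvent (hP : ∀ φ, P (j φ) = ι φ) {W : H →L[ℂ] H}
    (h : ∀ ε > 0, ∃ (κ : Type) (_ : Fintype κ) (g : κ → H) (C : ℝ), ∀ φ,
      ‖W (ι φ)‖ ^ 2 ≤ ε * ‖j φ‖ ^ 2 + C * ∑ i, ‖inner ℂ (g i) (ι φ)‖ ^ 2) :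
    IsCompactOperator (W ∘L formResolvent j P) := by
  have : IsCompactOperator (W ∘L formMap j P) := by
    refine isCompactOperator_of_forall_exists_inner fun ε hε => ?_
    obtain ⟨κ, _, g, C, hs⟩ := h ε hε
    refine ⟨κ, inferInstance, fun i => (formMap j P).adjoint (g i), C, fun v => ?_⟩
    have h1 : ‖W (P (v : E))‖ ^ 2 ≤ ε * ‖(v : E)‖ ^ 2
        + C * ∑ i, ‖inner ℂ (g i) (P (v : E))‖ ^ 2 :=
      formSpace_induction
        (p := fun v => ‖W (P v)‖ ^ 2 ≤ ε * ‖v‖ ^ 2 + C * ∑ i, ‖inner ℂ (g i) (P v)‖ ^ 2)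
        (isClosed_le (by fun_prop) (by fun_prop))
        (fun φ => by simpa only [hP] using hs φ) v.2
    simp only [ContinuousLinearMap.adjoint_inner_left]
    exact h1
  exact this.comp_clm (formMap j P).adjoint

/-- With v = J* f the eigenvalue is μ = ‖v‖² / ‖f‖². As J v = μ f, the lower bound on the form reads
c μ² ‖f‖² ≤ ‖v‖² = μ ‖f‖². -/
lemma exists_real_of_formResolvent_eq (hP : ∀ φ, P (j φ) = ι φ) {Q : H →L[ℂ] H} {c : ℝ}
    (hc : ∀ φ, c * ‖Q (ι φ)‖ ^ 2 ≤ ‖j φ‖ ^ 2) {f : H} (hf : f ≠ 0) (hQf : Q f = f) {μ : ℂ}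
    (hμ : μ ≠ 0) (hR : formResolvent j P f = μ • f) : ∃ m : ℝ, μ = m ∧ 0 < m ∧ c * m ≤ 1 := by
  set v := (formMap j P).adjoint f with hv
  have hv' : P (v : E) = μ • f := hR
  have h1 : inner ℂ f (μ • f) = ((‖v‖ ^ 2 : ℝ) : ℂ) := by
    rw [← hv']
    change inner ℂ f (formMap j P v) = _
    rw [← ContinuousLinearMap.adjoint_inner_left, ← hv, inner_self_eq_norm_sq_to_K]
    simp
  have h2 : c * ‖Q (P (v : E))‖ ^ 2 ≤ ‖(v : E)‖ ^ 2 :=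
    formSpace_induction (p := fun v => c * ‖Q (P v)‖ ^ 2 ≤ ‖v‖ ^ 2)
      (isClosed_le (by fun_prop) (by fun_prop)) (fun φ => by simpa only [hP] using hc φ) v.2
  have hf0 : 0 < ‖f‖ ^ 2 := by positivity
  rw [inner_smul_right, inner_self_eq_norm_sq_to_K] at h1
  have h3 : μ = ((‖v‖ ^ 2 / ‖f‖ ^ 2 : ℝ) : ℂ) := by
    rw [Complex.ofReal_div, eq_div_iff (by exact_mod_cast hf0.ne'), ← h1]
    simp
  refine ⟨_, h3, ?_, ?_⟩
  · have : ‖v‖ ^ 2 / ‖f‖ ^ 2 ≠ 0 := fun h => hμ (by rw [h3, h]; simp)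
    exact lt_of_le_of_ne (by positivity) this.symm
  · set m := ‖v‖ ^ 2 / ‖f‖ ^ 2 with hm
    have hm0 : 0 < m := lt_of_le_of_ne (by positivity) fun h => hμ (by rw [h3, ← h]; simp)
    have h4 : ‖(v : E)‖ ^ 2 = m * ‖f‖ ^ 2 := by
      rw [hm, div_mul_cancel₀ _ hf0.ne']; rfl
    rw [hv', map_smul, hQf, norm_smul, h3, h4, mul_pow] at h2
    have h5 : ‖(m : ℂ)‖ = m := by rw [Complex.norm_real, Real.norm_of_nonneg hm0.le]
    rw [h5] at h2
    have : c * m * (m * ‖f‖ ^ 2) ≤ 1 * (m * ‖f‖ ^ 2) := by linarith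
    exact le_of_mul_le_mul_right this (by positivity)

end Friedrichs

/-! ### Calculus and integration by parts for test functions -/

section TestFunctions

lemma conj_mem_testFunctions {φ : ℝ × UnitAddCircle → ℂ} (hφ : φ ∈ testFunctions) :
    (fun p => conj (φ p)) ∈ testFunctions := by
  refine mem_testFunctions_of_support hφ ?_ fun p hp => subset_tsupport φ ?_
  · exact Complex.conjCLE.contDiff.comp hφ.1
  · simpa using hp

lemma mul_mem_testFunctions {φ ψ : ℝ × UnitAddCircle → ℂ} (hφ : ContDiff ℝ ∞ (lift φ))
    (hψ : ψ ∈ testFunctions) : (fun p => φ p * ψ p) ∈ testFunctions :=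
  mem_testFunctions_of_support hψ (hφ.mul hψ.1) fun _ hp =>
    subset_tsupport ψ (right_ne_zero_of_mul hp)

lemma hasDerivAt_partialX {φ : ℝ × UnitAddCircle → ℂ} (h : ContDiff ℝ ∞ (lift φ))
    (p : ℝ × UnitAddCircle) : HasDerivAt (fun s : ℝ => φ (s, p.2)) (partialX φ p) p.1 :=
  (differentiableAt_x h p).hasDerivAt

lemma partialX_conj {φ : ℝ × UnitAddCircle → ℂ} (h : ContDiff ℝ ∞ (lift φ))
    (p : ℝ × UnitAddCircle) : partialX (fun q => conj (φ q)) p = conj (partialX φ p) :=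
  (hasDerivAt_partialX h p).star.deriv

lemma partialX_mul {φ ψ : ℝ × UnitAddCircle → ℂ} (h : ContDiff ℝ ∞ (lift φ))
    (h' : ContDiff ℝ ∞ (lift ψ)) (p : ℝ × UnitAddCircle) :
    partialX (fun q => φ q * ψ q) p = partialX φ p * ψ p + φ p * partialX ψ p :=
  ((hasDerivAt_partialX h p).mul (hasDerivAt_partialX h' p)).deriv

/-- Passes from the derivative at 0 of a translate, as in `partialY`, to the derivative at y on the
universal cover. -/
lemma partialY_eq {φ : ℝ × UnitAddCircle → ℂ} {x y : ℝ} {d : ℂ}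
    (h : HasDerivAt (fun s : ℝ => φ (x, (s : UnitAddCircle))) d y) : partialY φ (x, y) = d := by
  have h2 : HasDerivAt (fun s : ℝ => y + s) 1 0 := (hasDerivAt_id (0 : ℝ)).const_add y
  have h1' : HasDerivAt (fun s : ℝ => φ (x, (s : UnitAddCircle))) d (y + 0) := by rwa [add_zero]
  have h3 := (HasDerivAt.scomp (0 : ℝ) h1' h2).deriv
  simpa [Function.comp_def, partialY] using h3

lemma hasDerivAt_partialY {φ : ℝ × UnitAddCircle → ℂ} (h : ContDiff ℝ ∞ (lift φ))
    (x y : ℝ) : HasDerivAt (fun s : ℝ => φ (x, (s : UnitAddCircle))) (partialY φ (x, y)) y := by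
  have h1 : ContDiff ℝ ∞ (fun s : ℝ => lift φ (x, s)) := h.comp (by fun_prop)
  have h2 : DifferentiableAt ℝ (fun s : ℝ => φ (x, (s : UnitAddCircle))) y :=
    (h1.differentiable (by simp)).differentiableAt
  rw [partialY_eq h2.hasDerivAt]
  exact h2.hasDerivAt

lemma partialY_conj {φ : ℝ × UnitAddCircle → ℂ} (h : ContDiff ℝ ∞ (lift φ))
    (p : ℝ × UnitAddCircle) : partialY (fun q => conj (φ q)) p = conj (partialY φ p) :=
  ((differentiableAt_y h p).hasDerivAt).star.deriv

lemma partialY_mul {φ ψ : ℝ × UnitAddCircle → ℂ} (h : ContDiff ℝ ∞ (lift φ))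
    (h' : ContDiff ℝ ∞ (lift ψ)) (p : ℝ × UnitAddCircle) :
    partialY (fun q => φ q * ψ q) p = partialY φ p * ψ p + φ p * partialY ψ p := by
  have := ((differentiableAt_y h p).hasDerivAt.mul (differentiableAt_y h' p).hasDerivAt).deriv
  simp only [add_zero, QuotientAddGroup.mk_zero, Prod.mk.eta] at this
  exact this

lemma eq_zero_of_notMem_Ioi {φ : ℝ × UnitAddCircle → ℂ} (hφ : φ ∈ testFunctions)
    {p : ℝ × UnitAddCircle} (hp : p.1 ∉ Ioi (1 : ℝ)) : φ p = 0 :=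
  image_eq_zero_of_notMem_tsupport fun h => hp (hφ.2.2 h).1

/-- The factor g need not be differentiable outside (1, ∞), but all terms vanish there. -/
lemma partialX_mulX {g g' : ℝ → ℝ} (hg : ContDiffOn ℝ ∞ g (Ioi 1))
    (hg' : ∀ x ∈ Ioi (1 : ℝ), HasDerivAt g (g' x) x) (φ : testFunctions) (p : ℝ × UnitAddCircle) :
    partialX (mulX g hg φ).1 p = g' p.1 * φ.1 p + g p.1 * partialX φ.1 p := by
  by_cases hp : p.1 ∈ Ioi (1 : ℝ)
  · exact ((hg' _ hp).ofReal_comp.mul (hasDerivAt_partialX φ.2.1 p)).deriv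
  · have h1 : partialX (mulX g hg φ).1 p = 0 := eq_zero_of_notMem_Ioi (dX (mulX g hg φ)).2 hp
    have h2 : partialX φ.1 p = 0 := eq_zero_of_notMem_Ioi (dX φ).2 hp
    rw [h1, h2, eq_zero_of_notMem_Ioi φ.2 hp]; simp

lemma partialY_mulX {g : ℝ → ℝ} (hg : ContDiffOn ℝ ∞ g (Ioi 1)) (φ : testFunctions)
    (p : ℝ × UnitAddCircle) : partialY (mulX g hg φ).1 p = g p.1 * partialY φ.1 p :=
  ((differentiableAt_y φ.2.1 p).hasDerivAt.const_mul (g p.1 : ℂ)).deriv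

instance : IsProbabilityMeasure (volume : Measure UnitAddCircle) := ⟨by simp⟩

lemma volume_eq_haarAddCircle : (volume : Measure UnitAddCircle) = AddCircle.haarAddCircle := by
  rw [AddCircle.volume_eq_smul_haarAddCircle]; simp

lemma integrable_of_mem {μ : Measure (ℝ × UnitAddCircle)} [IsFiniteMeasureOnCompacts μ]
    {φ : ℝ × UnitAddCircle → ℂ} (hφ : φ ∈ testFunctions) : Integrable φ μ :=
  (continuous_of_mem hφ).integrable_of_hasCompactSupport hφ.2.1

lemma continuous_x {φ : ℝ × UnitAddCircle → ℂ} (hφ : φ ∈ testFunctions) (y : UnitAddCircle) :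
    Continuous fun x => φ (x, y) := (continuous_of_mem hφ).comp (by fun_prop)

lemma continuous_y {φ : ℝ × UnitAddCircle → ℂ} (hφ : φ ∈ testFunctions) (x : ℝ) :
    Continuous fun y => φ (x, y) := (continuous_of_mem hφ).comp (by fun_prop)

lemma exists_Icc {φ : ℝ × UnitAddCircle → ℂ} (hφ : φ ∈ testFunctions) :
    ∃ b : ℝ, 1 < b ∧ ∀ x, x ∉ Icc 1 b → ∀ y, φ (x, y) = 0 := by
  obtain ⟨b, hb⟩ := (hφ.2.1.isCompact.image continuous_fst).bddAbove
  refine ⟨max b 2, by simp, fun x hx y => ?_⟩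
  by_contra h
  have h1 : (x, y) ∈ tsupport φ := subset_tsupport φ h
  have h2 : (1 : ℝ) < x := (hφ.2.2 h1).1
  exact hx ⟨h2.le, (hb ⟨_, h1, rfl⟩).trans (le_max_left _ _)⟩

lemma hasCompactSupport_x {φ : ℝ × UnitAddCircle → ℂ} (hφ : φ ∈ testFunctions)
    (y : UnitAddCircle) : HasCompactSupport fun x => φ (x, y) := by
  obtain ⟨b, -, hb⟩ := exists_Icc hφ
  exact HasCompactSupport.intro isCompact_Icc fun x hx => hb x hx y

lemma integral_partialX (φ : testFunctions) (y : UnitAddCircle) :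
    ∫ x, partialX φ.1 (x, y) = 0 :=
  integral_eq_zero_of_hasDerivAt_of_integrable (fun x => hasDerivAt_partialX φ.2.1 (x, y))
    ((continuous_x (dX φ).2 y).integrable_of_hasCompactSupport (hasCompactSupport_x (dX φ).2 y))
    ((continuous_x φ.2 y).integrable_of_hasCompactSupport (hasCompactSupport_x φ.2 y))

lemma integral_partialY (φ : testFunctions) (x : ℝ) :
    ∫ y, partialY φ.1 (x, y) = 0 := by
  rw [← UnitAddCircle.intervalIntegral_preimage 0,
    intervalIntegral.integral_eq_sub_of_hasDerivAt
      (f := fun s : ℝ => φ.1 (x, (s : UnitAddCircle))) (fun y _ => hasDerivAt_partialY φ.2.1 x y)]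
  · have : ((0 + 1 : ℝ) : UnitAddCircle) = ((0 : ℝ) : UnitAddCircle) := by
      simp
    rw [this, sub_self]
  · exact ((continuous_y (dY φ).2 x).comp (AddCircle.continuous_mk' (1 : ℝ))).intervalIntegrable _ _

lemma integral_radialMeasure {a : ℝ} (ha : 0 < a) {E : Type*} [NormedAddCommGroup E]
    [NormedSpace ℝ E] (f : ℝ → E) :
    ∫ x, f x ∂radialMeasure a = ∫ x in Ici 1, (1 + x / a) ^ (-a) • f x := by
  rw [radialMeasure, integral_withDensity_eq_integral_toReal_smul (by fun_prop)
    (Filter.Eventually.of_forall fun _ => ENNReal.ofReal_lt_top)]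
  refine setIntegral_congr_fun measurableSet_Ici fun x hx => ?_
  have hx' : (1 : ℝ) ≤ x := hx
  have : 0 < 1 + x / a := by positivity
  change (ENNReal.ofReal ((1 + x / a) ^ (-a))).toReal • f x = _
  rw [ENNReal.toReal_ofReal (by positivity)]

/-- The density is absorbed into the test function, leaving a flat integral over ℝ × S¹ to which the
divergence theorem applies without boundary terms. -/
lemma integral_cuspMeasure {a : ℝ} (ha : 0 < a) (φ : testFunctions) :
    ∫ p, φ.1 p ∂cuspMeasure a
      = ∫ x, ∫ y, (mulX (fun x => (1 + x / a) ^ (-a)) (contDiffOn_rpow ha (-a)) φ).1 (x, y) := by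
  have := isFiniteMeasureOnCompacts ha
  have hi : Integrable φ.1 (cuspMeasure a) := integrable_of_mem φ.2
  rw [cuspMeasure, integral_prod _ hi, integral_radialMeasure ha,
    setIntegral_eq_integral_of_forall_compl_eq_zero]
  · refine integral_congr_ae (Filter.Eventually.of_forall fun x => ?_)
    simp only [mulX, LinearMap.coe_mk, AddHom.coe_mk]
    rw [integral_const_mul, Complex.real_smul]
  · intro x hx
    have : ∀ y, φ.1 (x, y) = 0 := fun y =>
      eq_zero_of_notMem_Ioi φ.2 fun h : 1 < x => hx h.le
    simp [this]

lemma integral_dX_add_dY (φ ψ : testFunctions) :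
    ∫ x, ∫ y, (dX φ + dY ψ).1 (x, y) = 0 := by
  have h1 : ∀ x, ∫ y, (dX φ + dY ψ).1 (x, y) = ∫ y, (dX φ).1 (x, y) := by
    intro x
    have e : ∫ y, (dX φ + dY ψ).1 (x, y) = ∫ y, ((dX φ).1 (x, y) + (dY ψ).1 (x, y)) := rfl
    rw [e, integral_add, show ∫ y, (dY ψ).1 (x, y) = 0 from integral_partialY ψ x, add_zero]
    · exact (continuous_y (dX φ).2 x).integrable_of_hasCompactSupport (HasCompactSupport.of_compactSpace _)
    · exact (continuous_y (dY ψ).2 x).integrable_of_hasCompactSupport (HasCompactSupport.of_compactSpace _)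
  simp_rw [h1]
  rw [integral_integral_swap (f := fun x y => (dX φ).1 (x, y))]
  · have : ∀ y, ∫ x, (dX φ).1 (x, y) = 0 := integral_partialX φ
    simp [this]
  · exact integrable_of_mem (dX φ).2

end TestFunctions

/-! ### Green's formula on the cusp -/

section Form

lemma inner_toL2 {a : ℝ} (ha : 0 < a) (φ ψ : testFunctions) :
    inner ℂ (toL2 ha φ) (toL2 ha ψ) = ∫ p, conj (φ.1 p) * ψ.1 p ∂cuspMeasure a := by
  rw [L2.inner_def]
  refine integral_congr_ae ?_
  filter_upwards [(memLp_of_mem ha φ.2).coeFn_toLp, (memLp_of_mem ha ψ.2).coeFn_toLp] with p h1 h2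
  change inner ℂ ((memLp_of_mem ha φ.2).toLp φ.1 p) ((memLp_of_mem ha ψ.2).toLp ψ.1 p) = _
  rw [h1, h2, RCLike.inner_apply']

lemma integrable_conj_mul {a : ℝ} (ha : 0 < a) (φ ψ : testFunctions) :
    Integrable (fun p => conj (φ.1 p) * ψ.1 p) (cuspMeasure a) := by
  have := isFiniteMeasureOnCompacts ha
  exact integrable_of_mem (mul_mem_testFunctions (conj_mem_testFunctions φ.2).1 ψ.2)

/-- Green's formula. -/
lemma inner_gradient {a : ℝ} (ha : 0 < a) (φ ψ : testFunctions) :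
    inner ℂ (toL2 ha (dX φ)) (toL2 ha (dX ψ)) +
      inner ℂ (toL2 ha (mulX _ (contDiffOn_rpow ha a) (dY φ)))
        (toL2 ha (mulX _ (contDiffOn_rpow ha a) (dY ψ)))
      = -inner ℂ (toL2 ha φ) (toL2 ha (laplacian ha ψ)) := by
  rw [eq_neg_iff_add_eq_zero]
  simp only [inner_toL2]
  rw [← integral_add (integrable_conj_mul ha _ _) (integrable_conj_mul ha _ _)]
  refine (integral_add ((integrable_conj_mul ha _ _).add (integrable_conj_mul ha _ _))
    (integrable_conj_mul ha _ _)).symm.trans ?_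
  -- (A, B) is the density times φ̄ times the Riemannian gradient of ψ. The exponent of B is -a + 2a
  -- = a, since the inverse metric contributes (1 + x/a)^(2a).
  let A : testFunctions := mulX _ (contDiffOn_rpow ha (-a))
    ⟨_, mul_mem_testFunctions (conj_mem_testFunctions φ.2).1 (dX ψ).2⟩
  let B : testFunctions := mulX _ (contDiffOn_rpow ha a)
    ⟨_, mul_mem_testFunctions (conj_mem_testFunctions φ.2).1 (dY ψ).2⟩
  let G : testFunctions :=
    ⟨_, mul_mem_testFunctions (conj_mem_testFunctions (dX φ).2).1 (dX ψ).2⟩ +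
    ⟨_, mul_mem_testFunctions (conj_mem_testFunctions (mulX _ (contDiffOn_rpow ha a) (dY φ)).2).1
      (mulX _ (contDiffOn_rpow ha a) (dY ψ)).2⟩ +
    ⟨_, mul_mem_testFunctions (conj_mem_testFunctions φ.2).1 (laplacian ha ψ).2⟩
  -- The weighted integrand is a flat divergence; the first-order term of the Laplacian comes from
  -- differentiating the density in A.
  have key : mulX _ (contDiffOn_rpow ha (-a)) G = dX A + dY B := by
    refine Subtype.ext <| funext fun p => ?_
    by_cases hp : p.1 ∈ Ioi (1 : ℝ)
    · have hw := base_pos ha hp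
      have hd : ∀ x ∈ Ioi (1 : ℝ), HasDerivAt (fun x : ℝ => (1 + x / a) ^ (-a))
          (-((1 + x / a) ^ (-a) / (1 + x / a))) x := by
        intro x hx
        have h1 : HasDerivAt (fun x : ℝ => 1 + x / a) (1 / a) x :=
          ((hasDerivAt_id x).div_const a).const_add 1
        convert! h1.rpow_const (p := -a) (Or.inl (base_pos ha hx).ne') using 1
        rw [Real.rpow_sub_one (base_pos ha hx).ne']
        field_simp
      change _ = partialX A.1 p + partialY B.1 p
      rw [partialX_mulX _ hd, partialY_mulX]
      dsimp only
      rw [partialX_mul (conj_mem_testFunctions φ.2).1 (dX ψ).2.1,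
        partialY_mul (conj_mem_testFunctions φ.2).1 (dY ψ).2.1, partialX_conj φ.2.1,
        partialY_conj φ.2.1]
      change (((1 + p.1 / a) ^ (-a) : ℝ) : ℂ) * (conj (partialX φ.1 p) * partialX ψ.1 p +
        conj (((1 + p.1 / a) ^ a : ℝ) * partialY φ.1 p) * (((1 + p.1 / a) ^ a : ℝ) * partialY ψ.1 p)
        + conj (φ.1 p) * (partialX (partialX ψ.1) p
          - ((1 / (1 + p.1 / a) : ℝ) : ℂ) * partialX ψ.1 p
          + (((1 + p.1 / a) ^ (2 * a) : ℝ) : ℂ) * partialY (partialY ψ.1) p)) =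
        ((-((1 + p.1 / a) ^ (-a) / (1 + p.1 / a)) : ℝ) : ℂ) * (conj (φ.1 p) * partialX ψ.1 p)
        + (((1 + p.1 / a) ^ (-a) : ℝ) : ℂ) * (conj (partialX φ.1 p) * partialX ψ.1 p
          + conj (φ.1 p) * partialX (partialX ψ.1) p)
        + (((1 + p.1 / a) ^ a : ℝ) : ℂ) * (conj (partialY φ.1 p) * partialY ψ.1 p
          + conj (φ.1 p) * partialY (partialY ψ.1) p)
      have e2 : (1 + p.1 / a) ^ (2 * a) = (1 + p.1 / a) ^ a * (1 + p.1 / a) ^ a := by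
        rw [two_mul, Real.rpow_add hw]
      have e1 : (1 + p.1 / a) ^ (-a) * (1 + p.1 / a) ^ a = 1 := by
        rw [← Real.rpow_add hw]; simp
      rw [e2]
      generalize (1 + p.1 / a) ^ (-a) = u at *
      generalize (1 + p.1 / a) ^ a = w at *
      have e1' : (u : ℂ) * (w : ℂ) = 1 := by exact_mod_cast e1
      simp only [map_mul, Complex.conj_ofReal, Complex.ofReal_mul, Complex.ofReal_div,
        Complex.ofReal_neg, Complex.ofReal_one]
      linear_combination (w * (conj (partialY φ.1 p) * partialY ψ.1 p
          + conj (φ.1 p) * partialY (partialY ψ.1) p)) * e1'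
    · rw [eq_zero_of_notMem_Ioi (dX A + dY B).2 hp,
        eq_zero_of_notMem_Ioi (mulX _ (contDiffOn_rpow ha (-a)) G).2 hp]
  have := integral_cuspMeasure ha G
  rw [key, integral_dX_add_dY] at this
  exact this

end Form

/-! ### Fourier modes of test functions -/

section Fourier

/-- The `n`-th Fourier coefficient in the second variable. -/
noncomputable def coeff (n : ℤ) (φ : ℝ × UnitAddCircle → ℂ) (x : ℝ) : ℂ :=
  ∫ y : UnitAddCircle, fourier (-n) y * φ (x, y)

lemma norm_fourier (n : ℤ) (y : UnitAddCircle) : ‖(fourier n y : ℂ)‖ = 1 := by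
  rw [fourier_apply]; exact Circle.norm_coe _

lemma integral_fourier_neg_mul_fourier (m n : ℤ) :
    ∫ y : UnitAddCircle, (fourier (-m) y : ℂ) * fourier n y = if m = n then 1 else 0 := by
  have h := congrFun (fourierCoeff_fourier (T := 1) n) m
  rw [fourierCoeff, ← volume_eq_haarAddCircle] at h
  simp only [smul_eq_mul] at h
  rw [h, Pi.single_apply]

lemma coeff_eq_fourierCoeff (n : ℤ) (φ : ℝ × UnitAddCircle → ℂ) (x : ℝ) :
    coeff n φ x = fourierCoeff (fun y => φ (x, y)) n := by
  rw [coeff, fourierCoeff, volume_eq_haarAddCircle]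
  simp only [smul_eq_mul]

lemma hasSum_sq_fourierCoeff_of_memLp {f : UnitAddCircle → ℂ}
    (h : MemLp f 2 AddCircle.haarAddCircle) :
    HasSum (fun n => ‖fourierCoeff f n‖ ^ 2) (∫ y, ‖f y‖ ^ 2 ∂AddCircle.haarAddCircle) := by
  have h1 := hasSum_sq_fourierCoeff h.toLp
  rw [fourierCoeff_congr_ae h.coeFn_toLp] at h1
  have h2 : ∫ t, ‖h.toLp f t‖ ^ 2 ∂AddCircle.haarAddCircle
      = ∫ y, ‖f y‖ ^ 2 ∂AddCircle.haarAddCircle := by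
    refine integral_congr_ae ?_
    filter_upwards [h.coeFn_toLp] with y hy
    rw [hy]
  rwa [h2] at h1

/-- Parseval's identity. -/
lemma hasSum_sq_coeff {φ : ℝ × UnitAddCircle → ℂ} {x : ℝ}
    (h : MemLp (fun y => φ (x, y)) 2 (volume : Measure UnitAddCircle)) :
    HasSum (fun n => ‖coeff n φ x‖ ^ 2) (∫ y, ‖φ (x, y)‖ ^ 2) := by
  rw [volume_eq_haarAddCircle] at h ⊢
  simp only [coeff_eq_fourierCoeff]
  exact hasSum_sq_fourierCoeff_of_memLp h

lemma contDiff_fourier (n : ℤ) :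
    ContDiff ℝ ∞ (lift fun p => (fourier n p.2 : ℂ)) := by
  have : (lift fun p => (fourier n p.2 : ℂ)) =
      fun p : ℝ × ℝ => Complex.exp (2 * Real.pi * Complex.I * n * (p.2 : ℂ)) := by
    funext p
    simp [lift]
  rw [this]
  exact (contDiff_const.mul (Complex.ofRealCLM.contDiff.comp contDiff_snd)).cexp

lemma partialY_fourier (n : ℤ) (p : ℝ × UnitAddCircle) :
    partialY (fun p => (fourier n p.2 : ℂ)) p = 2 * Real.pi * Complex.I * n * fourier n p.2 := by
  obtain ⟨x, y⟩ := p
  obtain ⟨y, rfl⟩ := QuotientAddGroup.mk_surjective y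
  have := hasDerivAt_fourier 1 n y
  rw [Complex.ofReal_one, div_one] at this
  exact partialY_eq this

lemma integrable_y {φ : ℝ × UnitAddCircle → ℂ} (hφ : φ ∈ testFunctions) (n : ℤ) (x : ℝ) :
    Integrable (fun y : UnitAddCircle => (fourier n y : ℂ) * φ (x, y)) :=
  ((map_continuous (fourier n)).mul (continuous_y hφ x)).integrable_of_hasCompactSupport
    (HasCompactSupport.of_compactSpace _)

/-- Differentiation under the integral, dominated by the supremum of |∂_x φ| on the circle, which
has finite measure. -/
lemma hasDerivAt_coeff (n : ℤ) (φ : testFunctions) (x : ℝ) :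
    HasDerivAt (coeff n φ.1) (coeff n (dX φ).1 x) x := by
  obtain ⟨C, hC⟩ := (dX φ).2.2.1.exists_bound_of_continuous (continuous_of_mem (dX φ).2)
  refine (hasDerivAt_integral_of_dominated_loc_of_deriv_le (μ := volume)
    (F := fun x (y : UnitAddCircle) => (fourier (-n) y : ℂ) * φ.1 (x, y))
    (F' := fun x (y : UnitAddCircle) => (fourier (-n) y : ℂ) * (dX φ).1 (x, y))
    (bound := fun _ => C) Filter.univ_mem
    (Filter.Eventually.of_forall fun x => (integrable_y φ.2 (-n) x).aestronglyMeasurable)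
    (integrable_y φ.2 (-n) x) (integrable_y (dX φ).2 (-n) x).aestronglyMeasurable
    (Filter.Eventually.of_forall fun y x _ => ?_) (integrable_const C)
    (Filter.Eventually.of_forall fun y x _ => ?_)).2
  · rw [norm_mul, norm_fourier, one_mul]
    exact hC _
  · exact (hasDerivAt_partialX φ.2.1 (x, y)).const_mul _

lemma contDiff_coeff (n : ℤ) (φ : testFunctions) : ContDiff ℝ ∞ (coeff n φ.1) := by
  rw [contDiff_infty]
  intro k
  induction k generalizing φ with
  | zero =>
    exact contDiff_zero.2 (continuous_iff_continuousAt.2 fun x =>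
      (hasDerivAt_coeff n φ x).continuousAt)
  | succ k ih =>
    rw [Nat.cast_succ, contDiff_succ_iff_deriv]
    refine ⟨fun x => (hasDerivAt_coeff n φ x).differentiableAt, by simp, ?_⟩
    have : deriv (coeff n φ.1) = coeff n (dX φ).1 := funext fun x => (hasDerivAt_coeff n φ x).deriv
    rw [this]
    exact ih _

lemma coeff_eq_zero {φ : ℝ × UnitAddCircle → ℂ} {x : ℝ} (h : ∀ y, φ (x, y) = 0) (n : ℤ) :
    coeff n φ x = 0 := by simp [coeff, h]

lemma hasCompactSupport_coeff (n : ℤ) (φ : testFunctions) : HasCompactSupport (coeff n φ.1) := by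
  obtain ⟨b, -, hb⟩ := exists_Icc φ.2
  exact HasCompactSupport.intro isCompact_Icc fun x hx => coeff_eq_zero (hb x hx) n

lemma mul_fourier_mem_testFunctions {v : ℝ → ℂ} (hv : ContDiff ℝ ∞ v) (hc : HasCompactSupport v)
    (hs : tsupport v ⊆ Ioi 1) (n : ℤ) :
    (fun p : ℝ × UnitAddCircle => v p.1 * fourier n p.2) ∈ testFunctions := by
  have hsub : Function.support (fun p : ℝ × UnitAddCircle => v p.1 * fourier n p.2) ⊆
      tsupport v ×ˢ univ := fun p hp => ⟨subset_tsupport v (left_ne_zero_of_mul hp), mem_univ _⟩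
  refine ⟨?_, ?_, ?_⟩
  · exact ContDiff.mul (f := fun p : ℝ × ℝ => v p.1) (hv.comp contDiff_fst) (contDiff_fourier n)
  · exact HasCompactSupport.of_support_subset_isCompact (hc.isCompact.prod isCompact_univ) hsub
  · exact (closure_minimal hsub ((isClosed_tsupport v).prod isClosed_univ)).trans
      (prod_mono hs subset_rfl)

lemma tsupport_coeff (n : ℤ) (φ : testFunctions) : tsupport (coeff n φ.1) ⊆ Ioi 1 := by
  have h1 : Function.support (coeff n φ.1) ⊆ Prod.fst '' tsupport φ.1 := by
    intro x hx
    by_contra h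
    refine hx (coeff_eq_zero (fun y => ?_) n)
    exact image_eq_zero_of_notMem_tsupport fun h' => h ⟨_, h', rfl⟩
  refine (closure_minimal h1 (φ.2.2.1.isCompact.image continuous_fst).isClosed).trans ?_
  rintro _ ⟨p, hp, rfl⟩
  exact (φ.2.2.2 hp).1

/-- The projection of a test function onto its `n`-th Fourier mode. -/
noncomputable def project (n : ℤ) : testFunctions →ₗ[ℂ] testFunctions where
  toFun φ := ⟨_, mul_fourier_mem_testFunctions (contDiff_coeff n φ) (hasCompactSupport_coeff n φ)
    (tsupport_coeff n φ) n⟩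
  map_add' φ ψ := Subtype.ext <| funext fun p => by
    have : coeff n (φ + ψ).1 p.1 = coeff n φ.1 p.1 + coeff n ψ.1 p.1 := by
      rw [coeff, coeff, coeff, ← integral_add (integrable_y φ.2 _ _) (integrable_y ψ.2 _ _)]
      exact integral_congr_ae (Filter.Eventually.of_forall fun y => mul_add _ _ _)
    change coeff n (φ + ψ).1 p.1 * _ = coeff n φ.1 p.1 * _ + coeff n ψ.1 p.1 * _
    rw [this, add_mul]
  map_smul' c φ := Subtype.ext <| funext fun p => by
    have : coeff n (c • φ).1 p.1 = c * coeff n φ.1 p.1 := by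
      rw [coeff, coeff, ← integral_const_mul]
      exact integral_congr_ae (Filter.Eventually.of_forall fun y => mul_left_comm _ _ _)
    change coeff n (c • φ).1 p.1 * _ = c * (coeff n φ.1 p.1 * _)
    rw [this, mul_assoc]

lemma project_apply (n : ℤ) (φ : testFunctions) (p : ℝ × UnitAddCircle) :
    (project n φ).1 p = coeff n φ.1 p.1 * fourier n p.2 := rfl

lemma coeff_project (m n : ℤ) (φ : testFunctions) (x : ℝ) :
    coeff m (project n φ).1 x = if m = n then coeff n φ.1 x else 0 := by
  have : coeff m (project n φ).1 x =
      ∫ y : UnitAddCircle, coeff n φ.1 x * ((fourier (-m) y : ℂ) * fourier n y) :=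
    integral_congr_ae (Filter.Eventually.of_forall fun y => mul_left_comm _ _ _)
  rw [this, integral_const_mul, integral_fourier_neg_mul_fourier]
  split_ifs <;> simp

lemma dX_project (n : ℤ) (φ : testFunctions) : dX (project n φ) = project n (dX φ) :=
  Subtype.ext <| funext fun p => by
    have := ((hasDerivAt_coeff n φ p.1).mul_const (fourier n p.2 : ℂ)).deriv
    exact this

lemma mulX_project {g : ℝ → ℝ} (hg : ContDiffOn ℝ ∞ g (Ioi 1)) (n : ℤ) (φ : testFunctions) :
    mulX g hg (project n φ) = project n (mulX g hg φ) := by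
  refine Subtype.ext <| funext fun p => ?_
  have : coeff n (mulX g hg φ).1 p.1 = g p.1 * coeff n φ.1 p.1 := by
    rw [coeff, coeff, ← integral_const_mul]
    exact integral_congr_ae (Filter.Eventually.of_forall fun y => mul_left_comm _ _ _)
  rw [project_apply, this, mul_assoc]
  rfl

/-- Integrate the y-derivative of e^{-2πiny} φ over the circle, which gives 0 by periodicity. -/
lemma coeff_dY (n : ℤ) (φ : testFunctions) (x : ℝ) :
    coeff n (dY φ).1 x = 2 * Real.pi * Complex.I * n * coeff n φ.1 x := by
  have h1 := integral_partialY ⟨_, mul_mem_testFunctions (contDiff_fourier (-n)) φ.2⟩ x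
  simp only [partialY_mul (contDiff_fourier (-n)) φ.2.1, partialY_fourier] at h1
  have h2 : ∫ y : UnitAddCircle, 2 * Real.pi * Complex.I * n * ((fourier (-n) y : ℂ) * φ.1 (x, y))
      = ∫ y : UnitAddCircle, (fourier (-n) y : ℂ) * (dY φ).1 (x, y) := by
    rw [← sub_eq_zero, ← integral_sub ((integrable_y φ.2 _ _).const_mul _)
      (integrable_y (dY φ).2 _ _), ← neg_eq_zero, ← integral_neg, ← h1]
    refine integral_congr_ae (Filter.Eventually.of_forall fun y => ?_)
    simp only [dY, LinearMap.coe_mk, AddHom.coe_mk]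
    push_cast
    ring
  rw [coeff, ← h2, integral_const_mul, coeff]

lemma dY_project (n : ℤ) (φ : testFunctions) : dY (project n φ) = project n (dY φ) := by
  refine Subtype.ext <| funext fun p => ?_
  obtain ⟨x, y⟩ := p
  obtain ⟨y, rfl⟩ := QuotientAddGroup.mk_surjective y
  rw [project_apply, coeff_dY]
  have := hasDerivAt_fourier 1 n y
  rw [Complex.ofReal_one, div_one] at this
  refine (partialY_eq (this.const_mul (coeff n φ.1 x))).trans ?_
  simp only
  ring_nf

/-- Each factor of the Laplacian commutes with the projection because its coefficients do not depend
on y. -/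
lemma laplacian_project {a : ℝ} (ha : 0 < a) (n : ℤ) (φ : testFunctions) :
    laplacian ha (project n φ) = project n (laplacian ha φ) := by
  simp only [laplacian, LinearMap.add_apply, LinearMap.sub_apply, LinearMap.comp_apply,
    dX_project, dY_project, mulX_project, map_add, map_sub]

end Fourier

/-! ### Mode subspaces of L² and their projections -/

section Modes

lemma measurePreserving_fst_cusp (a : ℝ) :
    MeasurePreserving Prod.fst (cuspMeasure a) (radialMeasure a) := measurePreserving_fst

lemma aestronglyMeasurable_fourier (a : ℝ) (n : ℤ) :
    AEStronglyMeasurable (fun p : ℝ × UnitAddCircle => (fourier n p.2 : ℂ)) (cuspMeasure a) :=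
  ((map_continuous (fourier n)).comp continuous_snd).aestronglyMeasurable

lemma eLpNorm_mul_fourier (a : ℝ) (n : ℤ) {v : ℝ → ℂ}
    (hv : AEStronglyMeasurable v (radialMeasure a)) :
    eLpNorm (fun p : ℝ × UnitAddCircle => v p.1 * fourier n p.2) 2 (cuspMeasure a)
      = eLpNorm v 2 (radialMeasure a) := by
  rw [← eLpNorm_comp_measurePreserving hv (measurePreserving_fst_cusp a)]
  exact eLpNorm_congr_norm_ae (Filter.Eventually.of_forall fun p => by
    rw [norm_mul, norm_fourier, mul_one]; rfl)

lemma memLp_mul_fourier {a : ℝ} (n : ℤ) {v : ℝ → ℂ} (hv : MemLp v 2 (radialMeasure a)) :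
    MemLp (fun p : ℝ × UnitAddCircle => v p.1 * fourier n p.2) 2 (cuspMeasure a) := by
  refine ⟨?_, by rw [eLpNorm_mul_fourier a n hv.1]; exact hv.2⟩
  exact (hv.1.comp_measurePreserving (measurePreserving_fst_cusp a)).mul
    (aestronglyMeasurable_fourier a n)

/-- The isometry `v ↦ v(x) e^{2π i n y}`. -/
noncomputable def modeIsometry (a : ℝ) (n : ℤ) : Lp ℂ 2 (radialMeasure a) →ₗᵢ[ℂ] L2 a where
  toFun v := (memLp_mul_fourier n (Lp.memLp v)).toLp
  map_add' v w := by
    rw [← MemLp.toLp_add, MemLp.toLp_eq_toLp_iff]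
    have := (measurePreserving_fst_cusp a).quasiMeasurePreserving.ae_eq_comp (Lp.coeFn_add v w)
    filter_upwards [this] with p hp
    have hp' : (v + w : Lp ℂ 2 (radialMeasure a)) p.1 = v p.1 + w p.1 := hp
    rw [hp', add_mul]; rfl
  map_smul' c v := by
    rw [RingHom.id_apply, ← MemLp.toLp_const_smul, MemLp.toLp_eq_toLp_iff]
    have := (measurePreserving_fst_cusp a).quasiMeasurePreserving.ae_eq_comp (Lp.coeFn_smul c v)
    filter_upwards [this] with p hp
    have hp' : (c • v : Lp ℂ 2 (radialMeasure a)) p.1 = c • v p.1 := hp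
    rw [hp', smul_mul_assoc]; rfl
  norm_map' v := by
    change ‖(memLp_mul_fourier n (Lp.memLp v)).toLp‖ = _
    rw [Lp.norm_toLp, eLpNorm_mul_fourier a n (Lp.aestronglyMeasurable v), Lp.norm_def]

/-- An isometric image of a complete space is closed; this is what provides the orthogonal
projection onto a mode. -/
lemma coe_modeSubspace (a : ℝ) (n : ℤ) :
    (modeSubspace a n : Set (L2 a)) = range (modeIsometry a n) := by
  ext u
  constructor
  · rintro ⟨v, hv, h⟩
    refine ⟨hv.toLp, Lp.ext ?_⟩
    refine (memLp_mul_fourier n (Lp.memLp hv.toLp)).coeFn_toLp.trans (Filter.EventuallyEq.trans ?_ h.symm)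
    have := (measurePreserving_fst_cusp a).quasiMeasurePreserving.ae_eq_comp hv.coeFn_toLp
    filter_upwards [this] with p hp
    have hp' : hv.toLp v p.1 = v p.1 := hp
    rw [hp']
  · rintro ⟨v, rfl⟩
    exact ⟨v, Lp.memLp v, (memLp_mul_fourier n (Lp.memLp v)).coeFn_toLp⟩

lemma isClosed_modeSubspace (a : ℝ) (n : ℤ) : IsClosed (modeSubspace a n : Set (L2 a)) := by
  rw [coe_modeSubspace]
  exact (modeIsometry a n).isometry.isClosedEmbedding.isClosed_range

instance (a : ℝ) (n : ℤ) : CompleteSpace (modeSubspace a n) :=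
  (isClosed_modeSubspace a n).completeSpace_coe

lemma inner_eq_integral_integral (a : ℝ) {u g : L2 a} {U G : ℝ × UnitAddCircle → ℂ}
    (hU : u =ᵐ[cuspMeasure a] U) (hG : g =ᵐ[cuspMeasure a] G) :
    inner ℂ u g = ∫ x, (∫ y : UnitAddCircle, conj (U (x, y)) * G (x, y)) ∂radialMeasure a := by
  have h : (fun p => inner ℂ (u p) (g p)) =ᵐ[cuspMeasure a] fun p => conj (U p) * G p := by
    filter_upwards [hU, hG] with p h1 h2
    rw [h1, h2, RCLike.inner_apply']
  rw [L2.inner_def, integral_congr_ae h, cuspMeasure, integral_prod]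
  exact (L2.integrable_inner u g).congr h

/-- By Fubini, integrating over the circle first leaves only the n-th coefficient of `G`. -/
lemma inner_mode_eq (a : ℝ) {u g : L2 a} {n : ℤ} {v : ℝ → ℂ} {G : ℝ × UnitAddCircle → ℂ}
    (hu : u =ᵐ[cuspMeasure a] fun p => v p.1 * fourier n p.2) (hG : g =ᵐ[cuspMeasure a] G) :
    inner ℂ u g = ∫ x, conj (v x) * coeff n G x ∂radialMeasure a := by
  rw [inner_eq_integral_integral a hu hG]
  refine integral_congr_ae (Filter.Eventually.of_forall fun x => ?_)
  simp only [coeff]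
  rw [← integral_const_mul]
  refine integral_congr_ae (Filter.Eventually.of_forall fun y => ?_)
  simp only [map_mul, fourier_neg]
  ring

lemma mem_orthogonal_modeSubspace (a : ℝ) {g : L2 a} {n : ℤ} {G : ℝ × UnitAddCircle → ℂ}
    (hG : g =ᵐ[cuspMeasure a] G) (h : ∀ x, coeff n G x = 0) : g ∈ (modeSubspace a n)ᗮ := by
  rintro u ⟨v, -, hu⟩
  rw [inner_mode_eq a hu hG]
  simp [h]

lemma modeSubspace_le_orthogonal (a : ℝ) {m n : ℤ} (hmn : m ≠ n) :
    modeSubspace a n ≤ (modeSubspace a m)ᗮ := by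
  rintro u ⟨v, -, hu⟩
  refine mem_orthogonal_modeSubspace a hu fun x => ?_
  have : coeff m (fun p : ℝ × UnitAddCircle => v p.1 * fourier n p.2) x =
      ∫ y : UnitAddCircle, v x * ((fourier (-m) y : ℂ) * fourier n y) :=
    integral_congr_ae (Filter.Eventually.of_forall fun y => mul_left_comm _ _ _)
  rw [this, integral_const_mul, integral_fourier_neg_mul_fourier, if_neg hmn, mul_zero]

lemma coeFn_toL2 {a : ℝ} (ha : 0 < a) (φ : testFunctions) : toL2 ha φ =ᵐ[cuspMeasure a] φ.1 :=
  (memLp_of_mem ha φ.2).coeFn_toLp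

lemma isFiniteMeasureOnCompacts_radialMeasure {a : ℝ} (ha : 0 < a) :
    IsFiniteMeasureOnCompacts (radialMeasure a) :=
  ⟨fun _ hK => (radialMeasure_le ha _).trans_lt hK.measure_lt_top⟩

/-- Identifies the Hilbert space projection with the explicit Fourier projection: the remainder has
vanishing n-th coefficient at every x. -/
lemma starProjection_toL2 {a : ℝ} (ha : 0 < a) (n : ℤ) (φ : testFunctions) :
    (modeSubspace a n).starProjection (toL2 ha φ) = toL2 ha (project n φ) := by
  have := isFiniteMeasureOnCompacts_radialMeasure ha
  refine (Submodule.eq_starProjection_of_mem_orthogonal ?_ ?_)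
  · exact ⟨coeff n φ.1, (contDiff_coeff n φ).continuous.memLp_of_hasCompactSupport
      (hasCompactSupport_coeff n φ), coeFn_toL2 ha _⟩
  · rw [← map_sub]
    refine mem_orthogonal_modeSubspace a (coeFn_toL2 ha _) fun x => ?_
    have : coeff n (φ - project n φ).1 x = coeff n φ.1 x - coeff n (project n φ).1 x := by
      rw [coeff, coeff, coeff, ← integral_sub (integrable_y φ.2 _ _)
        (integrable_y (project n φ).2 _ _)]
      exact integral_congr_ae (Filter.Eventually.of_forall fun y => mul_sub _ _ _)
    rw [this, coeff_project, if_pos rfl, sub_self]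

end Modes

/-! ### Density of the test functions in L² -/

section Density

lemma ae_memLp_y {a : ℝ} (u : L2 a) :
    ∀ᵐ x ∂radialMeasure a, MemLp (fun y => u (x, y)) 2 (volume : Measure UnitAddCircle) := by
  have h1 : Integrable (fun p => ‖u p‖ ^ 2) ((radialMeasure a).prod volume) :=
    (memLp_two_iff_integrable_sq_norm (Lp.aestronglyMeasurable u)).1 (Lp.memLp u)
  have h2 := (Lp.aestronglyMeasurable u)
  filter_upwards [h1.prod_right_ae, h2.prodMk_left] with x hx hx'
  exact (memLp_two_iff_integrable_sq_norm hx').2 hx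

/-- Over a bounded x-interval the measure is finite, so u is integrable there and Fubini applies.
The fundamental lemma of the calculus of variations needs this. -/
lemma locallyIntegrableOn_coeff {a : ℝ} (ha : 0 < a) (u : L2 a) (n : ℤ) (s : Set ℝ) :
    LocallyIntegrableOn (coeff n u) s (radialMeasure a) := by
  have := isFiniteMeasureOnCompacts_radialMeasure ha
  intro x _
  refine ⟨Icc (x - 1) (x + 1), mem_nhdsWithin_of_mem_nhds (Icc_mem_nhds (by simp) (by simp)), ?_⟩
  have hfin : IsFiniteMeasure ((radialMeasure a).restrict (Icc (x - 1) (x + 1))) :=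
    ⟨by simpa using isCompact_Icc.measure_lt_top⟩
  have h1 : MemLp u 2 (((radialMeasure a).restrict (Icc (x - 1) (x + 1))).prod volume) := by
    rw [← Measure.restrict_univ (μ := (volume : Measure UnitAddCircle)), Measure.prod_restrict]
    exact (Lp.memLp u).restrict _
  have h2 : Integrable (fun p : ℝ × UnitAddCircle => (fourier (-n) p.2 : ℂ) * u p)
      (((radialMeasure a).restrict (Icc (x - 1) (x + 1))).prod volume) := by
    refine (h1.integrable (by norm_num)).bdd_mul (c := 1) ?_ ?_
    · exact ((map_continuous (fourier (-n))).comp continuous_snd).aestronglyMeasurable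
    · exact Filter.Eventually.of_forall fun p => (norm_fourier _ _).le
  exact h2.integral_prod_left

lemma ae_mem_Ioi (a : ℝ) : ∀ᵐ x ∂radialMeasure a, x ∈ Ioi (1 : ℝ) := by
  refine (withDensity_absolutelyContinuous _ _).ae_le ?_
  rw [← Measure.restrict_congr_set (Ioi_ae_eq_Ici (a := (1 : ℝ)) (μ := volume))]
  exact ae_restrict_mem measurableSet_Ioi

/-- Testing against g(x) e^{2πiny} shows that every Fourier coefficient vanishes for almost every x;
Parseval on almost every circle then gives u = 0. -/
lemma eq_zero_of_forall_inner_toL2_eq_zero {a : ℝ} (ha : 0 < a) {u : L2 a}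
    (h : ∀ φ, inner ℂ (toL2 ha φ) u = 0) : u = 0 := by
  have h1 : ∀ n : ℤ, ∀ᵐ x ∂radialMeasure a, x ∈ Ioi (1 : ℝ) → coeff n u x = 0 := by
    intro n
    refine isOpen_Ioi.ae_eq_zero_of_integral_contDiff_smul_eq_zero
      (locallyIntegrableOn_coeff ha u n _) fun g hg hc hs => ?_
    have hsupp : Function.support (fun x => (g x : ℂ)) = Function.support g := by
      ext x; simp
    have hmem := mul_fourier_mem_testFunctions (v := fun x => (g x : ℂ))
      (Complex.ofRealCLM.contDiff.comp hg)
      (by rw [HasCompactSupport, tsupport, hsupp]; exact hc) (by rwa [tsupport, hsupp]) n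
    have := h ⟨_, hmem⟩
    rw [inner_mode_eq a (v := fun x => (g x : ℂ)) (n := n) (coeFn_toL2 ha ⟨_, hmem⟩) (Filter.EventuallyEq.refl _ _)] at this
    simpa using this
  have h2 : ∀ᵐ x ∂radialMeasure a, ∀ᵐ y : UnitAddCircle, u (x, y) = 0 := by
    filter_upwards [ae_all_iff.2 h1, ae_mem_Ioi a, ae_memLp_y u] with x hx hx1 hm
    have h3 := hasSum_sq_coeff hm
    have h4 : (fun n => ‖coeff n u x‖ ^ 2) = fun _ => 0 := funext fun n => by simp [hx n hx1]
    rw [h4] at h3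
    have h5 := h3.unique hasSum_zero
    have hi := (memLp_two_iff_integrable_sq_norm hm.1).1 hm
    rw [integral_eq_zero_iff_of_nonneg (fun y => by positivity) hi] at h5
    filter_upwards [h5] with y hy
    simpa using hy
  have h3 : inner ℂ u u = 0 := by
    rw [inner_eq_integral_integral a (Filter.EventuallyEq.refl _ _) (Filter.EventuallyEq.refl _ _)]
    refine integral_eq_zero_of_ae ?_
    filter_upwards [h2] with x hx
    refine integral_eq_zero_of_ae ?_
    filter_upwards [hx] with y hy
    simp [hy]
  exact inner_self_eq_zero.1 h3

lemma dense_range_toL2 {a : ℝ} (ha : 0 < a) :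
    Dense (LinearMap.range (toL2 ha) : Set (L2 a)) := by
  rw [Submodule.dense_iff_topologicalClosure_eq_top, Submodule.topologicalClosure_eq_top_iff,
    Submodule.eq_bot_iff]
  intro u hu
  exact eq_zero_of_forall_inner_toL2_eq_zero ha fun φ => hu _ ⟨φ, rfl⟩

end Density

/-! ### Poincaré inequalities on an interval and on a grid -/

section Poincare

/-- Cauchy–Schwarz, from the nonnegativity of the integral of the squared deviation of g from its
mean. -/
lemma sq_integral_le {g : ℝ → ℝ} (hg : Continuous g) {l r : ℝ} (hlr : l < r) :
    (∫ x in l..r, g x) ^ 2 ≤ (r - l) * ∫ x in l..r, g x ^ 2 := by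
  have hpos : 0 < r - l := sub_pos.2 hlr
  set B := ∫ x in l..r, g x with hB
  have h0 : 0 ≤ ∫ x in l..r, (g x - B / (r - l)) ^ 2 :=
    intervalIntegral.integral_nonneg hlr.le fun x _ => sq_nonneg _
  have h1 : ∫ x in l..r, (g x - B / (r - l)) ^ 2 =
      (∫ x in l..r, g x ^ 2) - (2 * (B / (r - l))) * B + (r - l) * (B / (r - l)) ^ 2 := by
    have e : ∀ x, (g x - B / (r - l)) ^ 2 =
        g x ^ 2 - (2 * (B / (r - l))) * g x + (B / (r - l)) ^ 2 := fun x => by ring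
    simp_rw [e]
    rw [intervalIntegral.integral_add, intervalIntegral.integral_sub,
      intervalIntegral.integral_const_mul, intervalIntegral.integral_const, smul_eq_mul]
    all_goals exact Continuous.intervalIntegrable (by fun_prop) _ _
  rw [h1] at h0
  have h2 : (r - l) * ((∫ x in l..r, g x ^ 2) - (2 * (B / (r - l))) * B
      + (r - l) * (B / (r - l)) ^ 2) = (r - l) * (∫ x in l..r, g x ^ 2) - B ^ 2 := by
    field_simp
    ring
  nlinarith [mul_nonneg hpos.le h0]

/-- A Poincaré inequality on an interval. -/
lemma integral_sq_norm_le {f f' : ℝ → ℂ} (hf : ∀ x, HasDerivAt f (f' x) x) (hf' : Continuous f')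
    {l r : ℝ} (hlr : l < r) :
    ∫ x in l..r, ‖f x‖ ^ 2 ≤ 2 * (r - l) ^ 2 * (∫ x in l..r, ‖f' x‖ ^ 2)
      + 2 / (r - l) * ‖∫ x in l..r, f x‖ ^ 2 := by
  have hpos : 0 < r - l := sub_pos.2 hlr
  have hcf : Continuous f := continuous_iff_continuousAt.2 fun x => (hf x).continuousAt
  -- B bounds the oscillation of f, hence its distance to the mean m. Then |f|² ≤ 2B² + 2|m|², and
  -- integrating with B² ≤ (r - l)∫|f'|² produces both constants.
  set B := ∫ x in l..r, ‖f' x‖ with hB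
  set m : ℂ := ((r - l)⁻¹ : ℝ) • ∫ x in l..r, f x with hm
  have hB2 : B ^ 2 ≤ (r - l) * ∫ x in l..r, ‖f' x‖ ^ 2 := sq_integral_le hf'.norm hlr
  have h1 : ∀ x ∈ Icc l r, ∀ t ∈ Icc l r, ‖f x - f t‖ ≤ B := by
    intro x hx t ht
    rw [← intervalIntegral.integral_eq_sub_of_hasDerivAt (fun y _ => hf y)
      (hf'.intervalIntegrable _ _)]
    refine (intervalIntegral.norm_integral_le_abs_integral_norm).trans ?_
    rw [hB, ← abs_of_nonneg (intervalIntegral.integral_nonneg hlr.le fun y _ => norm_nonneg (f' y))]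
    refine intervalIntegral.abs_integral_mono_interval ?_
      (Filter.Eventually.of_forall fun y => norm_nonneg _) (hf'.norm.intervalIntegrable _ _)
    rw [uIoc_of_le hlr.le]
    rintro y ⟨hy1, hy2⟩
    exact ⟨(le_min ht.1 hx.1).trans_lt hy1, hy2.trans (max_le ht.2 hx.2)⟩
  have h2 : ∀ x ∈ Icc l r, ‖f x - m‖ ≤ B := by
    intro x hx
    have e : f x - m = ((r - l)⁻¹ : ℝ) • ∫ t in l..r, (f x - f t) := by
      rw [intervalIntegral.integral_sub (by simp) (hcf.intervalIntegrable _ _),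
        intervalIntegral.integral_const, smul_sub, inv_smul_smul₀ hpos.ne']
    have h3 : ‖∫ t in l..r, (f x - f t)‖ ≤ B * |r - l| := by
      refine intervalIntegral.norm_integral_le_of_norm_le_const fun t ht => ?_
      rw [uIoc_of_le hlr.le] at ht
      exact h1 x hx t (Ioc_subset_Icc_self ht)
    rw [e, norm_smul, Real.norm_of_nonneg (by positivity)]
    rw [abs_of_pos hpos] at h3
    calc (r - l)⁻¹ * ‖∫ t in l..r, (f x - f t)‖ ≤ (r - l)⁻¹ * (B * (r - l)) := by gcongr
      _ = B := by field_simp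
  have h3 : ∀ x ∈ Icc l r, ‖f x‖ ^ 2 ≤ 2 * B ^ 2 + 2 * ‖m‖ ^ 2 := by
    intro x hx
    have h4 : ‖f x‖ ≤ B + ‖m‖ := by
      calc ‖f x‖ = ‖(f x - m) + m‖ := by rw [sub_add_cancel]
        _ ≤ ‖f x - m‖ + ‖m‖ := norm_add_le _ _
        _ ≤ _ := by gcongr; exact h2 x hx
    nlinarith [norm_nonneg (f x), sq_nonneg (B - ‖m‖)]
  have h4 : ∫ x in l..r, ‖f x‖ ^ 2 ≤ ∫ x in l..r, (2 * B ^ 2 + 2 * ‖m‖ ^ 2) :=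
    intervalIntegral.integral_mono_on hlr.le ((hcf.norm.pow 2).intervalIntegrable _ _)
      (by simp) h3
  rw [intervalIntegral.integral_const, smul_eq_mul] at h4
  have h5 : ‖m‖ ^ 2 = ‖∫ x in l..r, f x‖ ^ 2 / (r - l) ^ 2 := by
    rw [hm, norm_smul, Real.norm_of_nonneg (by positivity)]
    field_simp
  rw [h5] at h4
  refine h4.trans ?_
  have h6 : (r - l) * (2 * B ^ 2 + 2 * (‖∫ x in l..r, f x‖ ^ 2 / (r - l) ^ 2)) =
      2 * (r - l) * B ^ 2 + 2 / (r - l) * ‖∫ x in l..r, f x‖ ^ 2 := by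
    field_simp
  rw [h6]
  have h7 : 2 * (r - l) * B ^ 2 ≤ 2 * (r - l) * ((r - l) * ∫ x in l..r, ‖f' x‖ ^ 2) := by gcongr
  linarith

/-- The `i`-th point of the subdivision of `[A, B]` into `N` intervals of equal length. -/
noncomputable def gridPoint (A B : ℝ) (N i : ℕ) : ℝ := A + i * ((B - A) / N)

lemma gridPoint_succ_sub (A B : ℝ) (N i : ℕ) :
    gridPoint A B N (i + 1) - gridPoint A B N i = (B - A) / N := by
  simp only [gridPoint]; push_cast; ring

/-- Poincaré on each of the N cells: refining the grid makes the factor of the derivative small, at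
the price of N functionals. -/
lemma integral_sq_norm_le_sum {f f' : ℝ → ℂ} (hf : ∀ x, HasDerivAt f (f' x) x)
    (hf' : Continuous f') {A B : ℝ} (hAB : A < B) {N : ℕ} (hN : 0 < N) :
    ∫ x in A..B, ‖f x‖ ^ 2 ≤ 2 * ((B - A) / N) ^ 2 * (∫ x in A..B, ‖f' x‖ ^ 2)
      + 2 / ((B - A) / N) *
        ∑ i : Fin N, ‖∫ x in gridPoint A B N i..gridPoint A B N (i + 1), f x‖ ^ 2 := by
  have hcf : Continuous f := continuous_iff_continuousAt.2 fun x => (hf x).continuousAt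
  have hN' : (0 : ℝ) < N := by exact_mod_cast hN
  have h0 : gridPoint A B N 0 = A := by simp [gridPoint]
  have hNN : gridPoint A B N N = B := by
    simp only [gridPoint]; field_simp; ring
  have e : ∀ g : ℝ → ℝ, Continuous g → ∫ x in A..B, g x =
      ∑ i : Fin N, ∫ x in gridPoint A B N i..gridPoint A B N (i + 1), g x := by
    intro g hg
    rw [Fin.sum_univ_eq_sum_range
      (fun i => ∫ x in gridPoint A B N i..gridPoint A B N (i + 1), g x) N,
      intervalIntegral.sum_integral_adjacent_intervals fun k _ => hg.intervalIntegrable _ _,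
      h0, hNN]
  rw [e (fun x => ‖f x‖ ^ 2) (by fun_prop), e (fun x => ‖f' x‖ ^ 2) (by fun_prop), Finset.mul_sum, Finset.mul_sum,
    ← Finset.sum_add_distrib]
  refine Finset.sum_le_sum fun i _ => ?_
  have hs := gridPoint_succ_sub A B N i
  have hlt : gridPoint A B N i < gridPoint A B N (i + 1) := by
    rw [← sub_pos, hs]
    exact div_pos (sub_pos.2 hAB) hN'
  have := integral_sq_norm_le hf hf' hlt
  rwa [hs] at this

end Poincare

/-! ### Estimates on each circle by Parseval -/

section Estimates

/-- The square of the `L²` norm over the circle at `x`. -/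
noncomputable def sqNorm (φ : ℝ × UnitAddCircle → ℂ) (x : ℝ) : ℝ :=
  ∫ y : UnitAddCircle, ‖φ (x, y)‖ ^ 2

lemma sqNorm_nonneg (φ : ℝ × UnitAddCircle → ℂ) (x : ℝ) : 0 ≤ sqNorm φ x :=
  integral_nonneg fun _ => by positivity

lemma hasSum_sqNorm (φ : testFunctions) (x : ℝ) :
    HasSum (fun n => ‖coeff n φ.1 x‖ ^ 2) (sqNorm φ.1 x) :=
  hasSum_sq_coeff ((continuous_y φ.2 x).memLp_of_hasCompactSupport
    (HasCompactSupport.of_compactSpace _))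

lemma sum_sq_coeff_le (φ : testFunctions) (x : ℝ) (s : Finset ℤ) :
    ∑ n ∈ s, ‖coeff n φ.1 x‖ ^ 2 ≤ sqNorm φ.1 x :=
  sum_le_hasSum s (fun _ _ => by positivity) (hasSum_sqNorm φ x)

lemma integrable_sqNorm {ν : Measure ℝ} [SFinite ν] [IsFiniteMeasureOnCompacts ν]
    (φ : testFunctions) : Integrable (sqNorm φ.1) ν := by
  have hc := continuous_of_mem φ.2
  have hc2 : Continuous fun p => ‖φ.1 p‖ ^ 2 := by fun_prop
  have hs : HasCompactSupport fun p => ‖φ.1 p‖ ^ 2 :=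
    HasCompactSupport.comp_left (g := fun z : ℂ => ‖z‖ ^ 2) φ.2.2.1 (by simp)
  have h : Integrable (fun p => ‖φ.1 p‖ ^ 2) (ν.prod (volume : Measure UnitAddCircle)) :=
    hc2.integrable_of_hasCompactSupport hs
  exact h.integral_prod_left

lemma norm_sq_toL2 {a : ℝ} (ha : 0 < a) (φ : testFunctions) :
    ‖toL2 ha φ‖ ^ 2 = ∫ x, sqNorm φ.1 x ∂radialMeasure a := by
  have h1 := inner_eq_integral_integral a (coeFn_toL2 ha φ) (coeFn_toL2 ha φ)
  rw [inner_self_eq_norm_sq_to_K] at h1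
  have h2 : ∀ x, ∫ y : UnitAddCircle, conj (φ.1 (x, y)) * φ.1 (x, y) = (sqNorm φ.1 x : ℂ) := by
    intro x
    rw [sqNorm, ← integral_complex_ofReal]
    refine integral_congr_ae (Filter.Eventually.of_forall fun y => ?_)
    simp only [RCLike.conj_mul]
    simp
  simp_rw [h2] at h1
  rw [integral_complex_ofReal] at h1
  exact Complex.ofReal_injective (by simpa using h1)

lemma norm_toL2_sq_le {a : ℝ} (ha : 0 < a) {φ ψ : testFunctions} {c : ℝ}
    (h : ∀ x ∈ Ioi (1 : ℝ), c * sqNorm φ.1 x ≤ sqNorm ψ.1 x) :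
    c * ‖toL2 ha φ‖ ^ 2 ≤ ‖toL2 ha ψ‖ ^ 2 := by
  have := isFiniteMeasureOnCompacts_radialMeasure ha
  rw [norm_sq_toL2, norm_sq_toL2, ← integral_const_mul]
  refine integral_mono_ae ((integrable_sqNorm φ).const_mul c) (integrable_sqNorm ψ) ?_
  filter_upwards [ae_mem_Ioi a] with x hx using h x hx

lemma sqNorm_project (n : ℤ) (φ : testFunctions) (x : ℝ) :
    sqNorm (project n φ).1 x = ‖coeff n φ.1 x‖ ^ 2 := by
  have : ∀ y, ‖(project n φ).1 (x, y)‖ ^ 2 = ‖coeff n φ.1 x‖ ^ 2 := fun y => by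
    rw [project_apply, norm_mul, norm_fourier, mul_one]
  simp [sqNorm, this]

/-- The vertical component of the gradient. -/
noncomputable def gradY {a : ℝ} (ha : 0 < a) : testFunctions →ₗ[ℂ] testFunctions :=
  mulX (fun x => (1 + x / a) ^ a) (contDiffOn_rpow ha a) ∘ₗ dY

lemma sqNorm_gradY {a : ℝ} (ha : 0 < a) (φ : testFunctions) {x : ℝ} (hx : x ∈ Ioi (1 : ℝ)) :
    sqNorm (gradY ha φ).1 x = (1 + x / a) ^ (2 * a) * sqNorm (dY φ).1 x := by
  have hw := base_pos ha hx
  rw [sqNorm, sqNorm, ← integral_const_mul]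
  refine integral_congr_ae (Filter.Eventually.of_forall fun y => ?_)
  change ‖(((1 + x / a) ^ a : ℝ) : ℂ) * (dY φ).1 (x, y)‖ ^ 2 = _
  rw [norm_mul, Complex.norm_real, Real.norm_of_nonneg (by positivity), mul_pow, two_mul,
    Real.rpow_add hw]
  ring

lemma one_le_base {a x : ℝ} (ha : 0 < a) (hx : x ∈ Ioi (1 : ℝ)) : 1 ≤ 1 + x / a := by
  have : 0 < x := lt_trans one_pos hx
  exact le_add_of_nonneg_right (by positivity)

lemma sqNorm_dY_le {a : ℝ} (ha : 0 < a) (φ : testFunctions) {x : ℝ} (hx : x ∈ Ioi (1 : ℝ)) :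
    sqNorm (dY φ).1 x ≤ sqNorm (gradY ha φ).1 x := by
  rw [sqNorm_gradY ha φ hx]
  exact le_mul_of_one_le_left (sqNorm_nonneg _ _)
    (Real.one_le_rpow (one_le_base ha hx) (by positivity))

lemma sq_norm_coeff_dY (n : ℤ) (φ : testFunctions) (x : ℝ) :
    ‖coeff n (dY φ).1 x‖ ^ 2 = 4 * Real.pi ^ 2 * (n : ℝ) ^ 2 * ‖coeff n φ.1 x‖ ^ 2 := by
  rw [coeff_dY, norm_mul, mul_pow]
  congr 1
  simp only [norm_mul, Complex.norm_real, Complex.norm_I, Complex.norm_intCast, mul_pow,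
    Real.norm_eq_abs, sq_abs, Complex.norm_ofNat]
  ring

/-- The source of the bound 4π²n²: a single Fourier term is at most the whole sum, both for φ and
for ∂_y φ, and the weight (1 + x/a)^(2a) is at least 1. -/
lemma norm_project_sq_le {a : ℝ} (ha : 0 < a) (n : ℤ) (φ : testFunctions) :
    (1 + 4 * Real.pi ^ 2 * (n : ℝ) ^ 2) * ‖toL2 ha (project n φ)‖ ^ 2
      ≤ ‖toL2 ha φ‖ ^ 2 + ‖toL2 ha (gradY ha φ)‖ ^ 2 := by
  rw [add_mul]
  refine add_le_add (norm_toL2_sq_le ha fun x _ => ?_) (norm_toL2_sq_le ha fun x hx => ?_)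
  · rw [one_mul, sqNorm_project]
    simpa using sum_sq_coeff_le φ x {n}
  · rw [sqNorm_project, ← sq_norm_coeff_dY]
    exact (by simpa using sum_sq_coeff_le (dY φ) x {n} :
      ‖coeff n (dY φ).1 x‖ ^ 2 ≤ sqNorm (dY φ).1 x).trans (sqNorm_dY_le ha φ hx)

lemma coeff_sub_project_zero (n : ℤ) (φ : testFunctions) (x : ℝ) :
    coeff n (φ - project 0 φ).1 x = if n = 0 then 0 else coeff n φ.1 x := by
  have : coeff n (φ - project 0 φ).1 x = coeff n φ.1 x - coeff n (project 0 φ).1 x := by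
    rw [coeff, coeff, coeff, ← integral_sub (integrable_y φ.2 _ _)
      (integrable_y (project 0 φ).2 _ _)]
    exact integral_congr_ae (Filter.Eventually.of_forall fun y => mul_sub _ _ _)
  rw [this, coeff_project]
  split_ifs with h
  · subst h; simp
  · simp

lemma one_le_four_mul_pi_sq : 1 ≤ 4 * Real.pi ^ 2 := by
  nlinarith [Real.pi_gt_three]

/-- Wirtinger's inequality with a crude constant: without the zero mode all factors 4π²n² are at
least 1. -/
lemma sqNorm_sub_project_le (φ : testFunctions) (x : ℝ) :
    sqNorm (φ - project 0 φ).1 x ≤ sqNorm (dY φ).1 x := by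
  refine hasSum_le (fun n => ?_) (hasSum_sqNorm (φ - project 0 φ) x) (hasSum_sqNorm (dY φ) x)
  rw [coeff_sub_project_zero, sq_norm_coeff_dY]
  split_ifs with h
  · simp; positivity
  · have h1 : (1 : ℝ) ≤ (n : ℝ) ^ 2 := by
      have : 1 ≤ n ^ 2 := by have := sq_pos_of_ne_zero h; omega
      exact_mod_cast this
    exact le_mul_of_one_le_left (by positivity)
      (one_le_mul_of_one_le_of_one_le one_le_four_mul_pi_sq h1)

/-- Modes with |n| > k satisfy 4π²n² ≥ k² and are absorbed by ∂_y φ. The finite sum also contains n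
= 0, which only enlarges the right side. -/
lemma sqNorm_sub_project_le_sum (φ : testFunctions) (x : ℝ) {k : ℕ} (hk : 0 < k) :
    sqNorm (φ - project 0 φ).1 x ≤ ((k : ℝ) ^ 2)⁻¹ * sqNorm (dY φ).1 x
      + ∑ n ∈ Finset.Icc (-(k : ℤ)) k, ‖coeff n φ.1 x‖ ^ 2 := by
  classical
  have h1 : HasSum (fun n : ℤ => if n ∈ Finset.Icc (-(k : ℤ)) k then ‖coeff n φ.1 x‖ ^ 2 else 0)
      (∑ n ∈ Finset.Icc (-(k : ℤ)) k, ‖coeff n φ.1 x‖ ^ 2) := by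
    rw [← Finset.sum_congr rfl fun n hn => if_pos hn]
    exact hasSum_sum_of_ne_finset_zero fun n hn => if_neg hn
  refine hasSum_le (fun n => ?_) (hasSum_sqNorm (φ - project 0 φ) x)
    (((hasSum_sqNorm (dY φ) x).mul_left ((k : ℝ) ^ 2)⁻¹).add h1)
  have hk' : (0 : ℝ) < k := by exact_mod_cast hk
  rw [coeff_sub_project_zero, sq_norm_coeff_dY]
  have hnn : 0 ≤ ((k : ℝ) ^ 2)⁻¹ * (4 * Real.pi ^ 2 * (n : ℝ) ^ 2 * ‖coeff n φ.1 x‖ ^ 2) := by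
    positivity
  split_ifs with h h' h'
  · simp; positivity
  · simp; positivity
  · linarith
  · rw [add_zero]
    have h1 : (k : ℝ) ^ 2 ≤ (n : ℝ) ^ 2 := by
      rw [Finset.mem_Icc] at h'
      have : (k : ℤ) ^ 2 ≤ n ^ 2 := by
        rw [sq_le_sq, abs_of_nonneg (by positivity)]
        by_contra h2
        exact h' (abs_le.1 (not_le.1 h2).le)
      exact_mod_cast this
    have h2 : (k : ℝ) ^ 2 ≤ 4 * Real.pi ^ 2 * (n : ℝ) ^ 2 :=
      h1.trans (le_mul_of_one_le_left (by positivity) one_le_four_mul_pi_sq)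
    rw [le_inv_mul_iff₀ (by positivity)]
    gcongr

end Estimates

/-! ### The compactness estimate off the zero mode -/

section Compactness

lemma radialMeasure_le_restrict {a : ℝ} (ha : 0 < a) :
    radialMeasure a ≤ volume.restrict (Ici 1) := by
  have h : radialMeasure a ≤ (volume.restrict (Ici 1)).withDensity 1 := by
    refine withDensity_mono ?_
    filter_upwards [ae_restrict_mem measurableSet_Ici] with x hx
    have hx' : (1 : ℝ) ≤ x := hx
    have h1 : 1 ≤ 1 + x / a := le_add_of_nonneg_right (by positivity)
    simpa using Real.rpow_le_one_of_one_le_of_nonpos h1 (by linarith)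
  rwa [withDensity_one] at h

lemma setIntegral_radialMeasure_le {a : ℝ} (ha : 0 < a) {X : ℝ} (hX : 1 ≤ X) {S : ℝ → ℝ}
    (hS : Continuous S) (h0 : ∀ x, 0 ≤ S x) :
    ∫ x in Iic X, S x ∂radialMeasure a ≤ ∫ x in (1 : ℝ)..X, S x := by
  have hle : (radialMeasure a).restrict (Iic X) ≤ volume.restrict (Icc 1 X) := by
    refine (Measure.restrict_mono_measure (radialMeasure_le_restrict ha) _).trans ?_
    rw [Measure.restrict_restrict measurableSet_Iic, inter_comm]
    rfl
  rw [intervalIntegral.integral_of_le hX, ← integral_Icc_eq_integral_Ioc]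
  exact integral_mono_measure hle (Filter.Eventually.of_forall h0)
    (hS.continuousOn.integrableOn_compact isCompact_Icc)

/-- On [1, X] the density is at least (1 + X/a)^(-a), so Lebesgue measure is controlled by the
radial measure. -/
lemma intervalIntegral_sqNorm_le {a : ℝ} (ha : 0 < a) {X : ℝ} (hX : 1 ≤ X) (φ : testFunctions) :
    ∫ x in (1 : ℝ)..X, sqNorm φ.1 x ≤ (1 + X / a) ^ a * ‖toL2 ha φ‖ ^ 2 := by
  have hX0 : 0 < 1 + X / a := by positivity
  have hfin := isFiniteMeasureOnCompacts_radialMeasure ha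
  have hint : IntegrableOn (fun x => (1 + x / a) ^ (-a) • sqNorm φ.1 x) (Ici 1) := by
    have h1 : Integrable (sqNorm φ.1) (radialMeasure a) := integrable_sqNorm φ
    rw [radialMeasure, integrable_withDensity_iff_integrable_smul' (by fun_prop)
      (Filter.Eventually.of_forall fun _ => ENNReal.ofReal_lt_top)] at h1
    refine h1.congr ?_
    filter_upwards [ae_restrict_mem measurableSet_Ici] with x hx
    have hx' : (1 : ℝ) ≤ x := hx
    have : 0 < 1 + x / a := by positivity
    rw [ENNReal.toReal_ofReal (by positivity)]
  rw [norm_sq_toL2, integral_radialMeasure ha, intervalIntegral.integral_of_le hX,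
    ← integral_Icc_eq_integral_Ioc, ← integral_const_mul]
  refine (setIntegral_mono_on ((integrable_sqNorm φ).integrableOn)
    ((hint.mono_set Icc_subset_Ici_self).const_mul _) measurableSet_Icc fun x hx => ?_).trans
    (setIntegral_mono_set (hint.const_mul _) ?_ Icc_subset_Ici_self.eventuallyLE)
  · have hx0 : 0 < 1 + x / a := by have : 0 < x := one_pos.trans_le hx.1; positivity
    have h1 : 1 + x / a ≤ 1 + X / a := by gcongr; exact hx.2
    have h2 : (1 + x / a) ^ a ≤ (1 + X / a) ^ a := Real.rpow_le_rpow hx0.le h1 ha.le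
    have h3 : (1 + x / a) ^ a * (1 + x / a) ^ (-a) = 1 := by
      rw [← Real.rpow_add hx0]; simp
    rw [smul_eq_mul, ← mul_assoc]
    refine le_mul_of_one_le_left (sqNorm_nonneg _ _) ?_
    exact h3.symm.le.trans (mul_le_mul_of_nonneg_right h2 (by positivity))
  · filter_upwards [ae_restrict_mem measurableSet_Ici] with x hx
    have hx' : (1 : ℝ) ≤ x := hx
    have : 0 < 1 + x / a := by positivity
    have := sqNorm_nonneg φ.1 x
    simp only [Pi.zero_apply, smul_eq_mul]
    positivity

/-- The representing vector is (1 + x/a)^a e^{2πiny} cut off to (l, r]; its weight cancels the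
density. -/
lemma exists_inner_eq_integral_coeff {a : ℝ} (ha : 0 < a) (n : ℤ) {l r : ℝ} (hl : 1 ≤ l)
    (hlr : l ≤ r) :
    ∃ g : L2 a, ∀ φ, inner ℂ g (toL2 ha φ) = ∫ x in l..r, coeff n φ.1 x := by
  have hfin := isFiniteMeasureOnCompacts_radialMeasure ha
  have hpos : ∀ x ∈ Ioc l r, 0 < 1 + x / a := fun x hx => by
    have : 0 < x := one_pos.trans_le (hl.trans hx.1.le)
    positivity
  set v : ℝ → ℂ := (Ioc l r).indicator fun x => (((1 + x / a) ^ a : ℝ) : ℂ) with hv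
  have hmem : MemLp v 2 (radialMeasure a) := by
    rw [memLp_indicator_iff_restrict measurableSet_Ioc]
    have : IsFiniteMeasure ((radialMeasure a).restrict (Ioc l r)) :=
      ⟨by simpa using (measure_mono Ioc_subset_Icc_self).trans_lt isCompact_Icc.measure_lt_top⟩
    refine MemLp.of_bound (Measurable.aestronglyMeasurable (by fun_prop)) ((1 + r / a) ^ a) ?_
    filter_upwards [ae_restrict_mem measurableSet_Ioc] with x hx
    have hx0 := hpos x hx
    rw [Complex.norm_real, Real.norm_of_nonneg (by positivity)]
    exact Real.rpow_le_rpow hx0.le (by gcongr; exact hx.2) ha.le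
  refine ⟨(memLp_mul_fourier n hmem).toLp, fun φ => ?_⟩
  rw [inner_mode_eq a (memLp_mul_fourier n hmem).coeFn_toLp (coeFn_toL2 ha φ),
    integral_radialMeasure ha, intervalIntegral.integral_of_le hlr]
  have hsub : Ioc l r ⊆ Ici 1 := fun x hx => hl.trans hx.1.le
  rw [setIntegral_eq_of_subset_of_forall_sdiff_eq_zero measurableSet_Ici hsub]
  · refine setIntegral_congr_fun measurableSet_Ioc fun x hx => ?_
    have hx0 := hpos x hx
    have h3 : (((1 + x / a) ^ (-a) : ℝ) : ℂ) * (((1 + x / a) ^ a : ℝ) : ℂ) = 1 := by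
      rw [← Complex.ofReal_mul, ← Real.rpow_add hx0]; simp
    simp only [hv, indicator_of_mem hx, Complex.conj_ofReal, Complex.real_smul]
    rw [← mul_assoc, h3, one_mul]
  · rintro x ⟨-, hx⟩
    simp [hv, indicator_of_notMem hx]

/-- Split at x = X. Beyond X the growing weight in the vertical gradient beats 1/ε; up to X the
modes |n| > k are absorbed and the others are kept. -/
lemma norm_sub_project_sq_le {a : ℝ} (ha : 0 < a) {ε X : ℝ} (hX : 1 ≤ X)
    (hXε : (1 + X / a) ^ (-(2 * a)) ≤ ε) {k : ℕ} (hk : 0 < k) (hkε : ((k : ℝ) ^ 2)⁻¹ ≤ ε)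
    (φ : testFunctions) :
    ‖toL2 ha (φ - project 0 φ)‖ ^ 2 ≤ ε * ‖toL2 ha (gradY ha φ)‖ ^ 2
      + ∑ n ∈ Finset.Icc (-(k : ℤ)) k, ∫ x in (1 : ℝ)..X, ‖coeff n φ.1 x‖ ^ 2 := by
  have hfin := isFiniteMeasureOnCompacts_radialMeasure ha
  have hc : ∀ n : ℤ, Continuous (coeff n φ.1) := fun n => (contDiff_coeff n φ).continuous
  set S : ℝ → ℝ := fun x => ∑ n ∈ Finset.Icc (-(k : ℤ)) k, ‖coeff n φ.1 x‖ ^ 2 with hS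
  have hSc : Continuous S := by fun_prop
  have hS0 : ∀ x, 0 ≤ S x := fun x => Finset.sum_nonneg fun _ _ => by positivity
  have hSi : IntegrableOn S (Iic X) (radialMeasure a) := by
    have : Integrable S (radialMeasure a) := by
      refine (integrable_sqNorm φ).mono hSc.aestronglyMeasurable
        (Filter.Eventually.of_forall fun x => ?_)
      rw [Real.norm_of_nonneg (hS0 x), Real.norm_of_nonneg (sqNorm_nonneg _ _)]
      exact sum_sq_coeff_le φ x _
    exact this.integrableOn
  rw [norm_sq_toL2, norm_sq_toL2]
  calc ∫ x, sqNorm (φ - project 0 φ).1 x ∂radialMeasure a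
      ≤ ∫ x, (ε * sqNorm (gradY ha φ).1 x + (Iic X).indicator S x) ∂radialMeasure a := by
        refine integral_mono_ae (integrable_sqNorm _)
          (((integrable_sqNorm _).const_mul ε).add (hSi.integrable_indicator measurableSet_Iic)) ?_
        filter_upwards [ae_mem_Ioi a] with x hx
        by_cases hxX : x ∈ Iic X
        · simp only [indicator_of_mem hxX]
          refine (sqNorm_sub_project_le_sum φ x hk).trans ?_
          have hε : 0 ≤ ε := le_trans (by positivity) hkε
          gcongr
          · exact sqNorm_nonneg _ _
          · exact sqNorm_dY_le ha φ hx
        · simp only [indicator_of_notMem hxX, add_zero]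
          refine (sqNorm_sub_project_le φ x).trans ?_
          have hxX' : X ≤ x := (not_le.1 hxX).le
          have hw := base_pos ha hx
          have hX0 : 0 < 1 + X / a := by positivity
          have h1 : (1 + x / a) ^ (-(2 * a)) ≤ ε := by
            refine le_trans ?_ hXε
            exact Real.rpow_le_rpow_of_nonpos hX0 (by gcongr) (by linarith)
          have h2 : (1 + x / a) ^ (-(2 * a)) * (1 + x / a) ^ (2 * a) = 1 := by
            rw [← Real.rpow_add hw]; simp
          rw [sqNorm_gradY ha φ hx, ← mul_assoc]
          refine le_mul_of_one_le_left (sqNorm_nonneg _ _) ?_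
          exact h2.symm.le.trans (mul_le_mul_of_nonneg_right h1 (by positivity))
    _ = ε * ∫ x, sqNorm (gradY ha φ).1 x ∂radialMeasure a + ∫ x in Iic X, S x ∂radialMeasure a := by
        rw [integral_add ((integrable_sqNorm _).const_mul ε)
          (hSi.integrable_indicator measurableSet_Iic), integral_const_mul,
          integral_indicator measurableSet_Iic]
    _ ≤ _ := by
        gcongr
        refine (setIntegral_radialMeasure_le ha hX hSc hS0).trans_eq ?_
        exact intervalIntegral.integral_finsetSum fun n _ =>
          Continuous.intervalIntegrable (by fun_prop) _ _

/-- To be applied to ∂_x φ. The constant does not depend on the set of modes, so a grid can be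
chosen independently of k. -/
lemma sum_integral_coeff_dX_le {a : ℝ} (ha : 0 < a) {X : ℝ} (hX : 1 ≤ X) (s : Finset ℤ)
    (φ : testFunctions) :
    ∑ n ∈ s, ∫ x in (1 : ℝ)..X, ‖coeff n φ.1 x‖ ^ 2 ≤ (1 + X / a) ^ a * ‖toL2 ha φ‖ ^ 2 := by
  have hc : ∀ n : ℤ, Continuous (coeff n φ.1) := fun n => (contDiff_coeff n φ).continuous
  refine le_trans ?_ (intervalIntegral_sqNorm_le ha hX φ)
  rw [← intervalIntegral.integral_finsetSum fun n _ =>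
    Continuous.intervalIntegrable (by fun_prop) _ _]
  refine intervalIntegral.integral_mono_on hX (Continuous.intervalIntegrable (by fun_prop) _ _)
    (integrable_sqNorm φ).intervalIntegrable fun x _ => sum_sq_coeff_le φ x s

/-- On the orthogonal complement of the zero mode, the `H¹` norm controls the `L²` norm up to an
arbitrarily small factor and finitely many functionals. -/
lemma exists_norm_sub_project_sq_le {a : ℝ} (ha : 0 < a) {ε : ℝ} (hε : 0 < ε) :
    ∃ (κ : Type) (_ : Fintype κ) (g : κ → L2 a) (C : ℝ), ∀ φ,
      ‖toL2 ha (φ - project 0 φ)‖ ^ 2 ≤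
        ε * (‖toL2 ha (dX φ)‖ ^ 2 + ‖toL2 ha (gradY ha φ)‖ ^ 2)
          + C * ∑ i, ‖inner ℂ (g i) (toL2 ha φ)‖ ^ 2 := by
  -- X makes the end of the cusp small and k the high modes. N makes the Poincaré constant small
  -- even after multiplication by the factor (1 + X/a)^a from comparing the measures on [1, X].
  obtain ⟨X, hXε, hX⟩ : ∃ X : ℝ, (1 + X / a) ^ (-(2 * a)) ≤ ε ∧ 1 < X := by
    have h1 : Filter.Tendsto (fun X : ℝ => 1 + X / a) Filter.atTop Filter.atTop :=
      Filter.tendsto_atTop_add_const_left _ _ (Filter.tendsto_id.atTop_div_const ha)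
    have h2 := (tendsto_rpow_neg_atTop (show 0 < 2 * a by positivity)).comp h1
    exact ((h2.eventually_le_const hε).and (Filter.eventually_gt_atTop 1)).exists
  obtain ⟨k, hkε, hk⟩ : ∃ k : ℕ, ((k : ℝ) ^ 2)⁻¹ ≤ ε ∧ 0 < k := by
    have h1 : Filter.Tendsto (fun k : ℕ => ((k : ℝ) ^ 2)⁻¹) Filter.atTop (nhds 0) :=
      ((Filter.tendsto_pow_atTop two_ne_zero).comp tendsto_natCast_atTop_atTop).inv_tendsto_atTop
    exact ((h1.eventually_le_const hε).and (Filter.eventually_gt_atTop 0)).exists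
  obtain ⟨N, hNε, hN⟩ : ∃ N : ℕ, 2 * ((X - 1) / N) ^ 2 * (1 + X / a) ^ a ≤ ε ∧ 0 < N := by
    have h0 : Filter.Tendsto (fun N : ℕ => (X - 1) / N) Filter.atTop (nhds 0) :=
      tendsto_const_div_atTop_nhds_zero_nat _
    have h1 : Filter.Tendsto (fun N : ℕ => 2 * ((X - 1) / N) ^ 2 * (1 + X / a) ^ a) Filter.atTop
        (nhds 0) := by
      simpa using ((h0.pow 2).const_mul 2).mul_const ((1 + X / a) ^ a)
    exact ((h1.eventually_le_const hε).and (Filter.eventually_gt_atTop 0)).exists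
  have hgrid : ∀ i : ℕ, 1 ≤ gridPoint 1 X N i := fun i => by
    have : 0 ≤ X - 1 := by linarith
    exact le_add_of_nonneg_right (by positivity)
  have hmono : ∀ i : ℕ, gridPoint 1 X N i ≤ gridPoint 1 X N (i + 1) := fun i => by
    rw [← sub_nonneg, gridPoint_succ_sub]
    have : 0 ≤ X - 1 := by linarith
    positivity
  choose g hg using fun (n : ℤ) (i : ℕ) =>
    exists_inner_eq_integral_coeff ha n (hgrid i) (hmono i)
  refine ⟨Finset.Icc (-(k : ℤ)) k × Fin N, inferInstance, fun p => g p.1 p.2,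
    2 / ((X - 1) / N), fun φ => ?_⟩
  simp only [hg]
  have h1 := norm_sub_project_sq_le ha hX.le hXε hk hkε φ
  have h2 : ∀ n : ℤ, ∫ x in (1 : ℝ)..X, ‖coeff n φ.1 x‖ ^ 2 ≤
      2 * ((X - 1) / N) ^ 2 * (∫ x in (1 : ℝ)..X, ‖coeff n (dX φ).1 x‖ ^ 2)
      + 2 / ((X - 1) / N) * ∑ i : Fin N,
        ‖∫ x in gridPoint 1 X N i..gridPoint 1 X N (i + 1), coeff n φ.1 x‖ ^ 2 := fun n =>
    integral_sq_norm_le_sum (hasDerivAt_coeff n φ) (contDiff_coeff n (dX φ)).continuous hX hN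
  have h3 := Finset.sum_le_sum fun n (_ : n ∈ Finset.Icc (-(k : ℤ)) k) => h2 n
  rw [Finset.sum_add_distrib, ← Finset.mul_sum, ← Finset.mul_sum] at h3
  have h4 := sum_integral_coeff_dX_le ha hX.le (Finset.Icc (-(k : ℤ)) k) (dX φ)
  have h5 : 2 * ((X - 1) / N) ^ 2 *
      ∑ n ∈ Finset.Icc (-(k : ℤ)) k, ∫ x in (1 : ℝ)..X, ‖coeff n (dX φ).1 x‖ ^ 2
      ≤ ε * ‖toL2 ha (dX φ)‖ ^ 2 := by
    calc _ ≤ 2 * ((X - 1) / N) ^ 2 * ((1 + X / a) ^ a * ‖toL2 ha (dX φ)‖ ^ 2) := by gcongr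
      _ = 2 * ((X - 1) / N) ^ 2 * (1 + X / a) ^ a * ‖toL2 ha (dX φ)‖ ^ 2 := by ring
      _ ≤ _ := by gcongr
  rw [Fintype.sum_prod_type, Finset.sum_coe_sort (Finset.Icc (-(k : ℤ)) k) (fun n => ∑ i : Fin N,
    ‖∫ x in gridPoint 1 X N i..gridPoint 1 X N (i + 1), coeff n φ.1 x‖ ^ 2)]
  linarith

end Compactness

/-! ### The Dirichlet Laplacian of the cusp -/

section Dirichlet

/-- `L² × L² × L²` with its Hilbert space norm. -/
abbrev GradientSpace (a : ℝ) : Type := WithLp 2 (L2 a × WithLp 2 (L2 a × L2 a))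

/-- The identity from `L² × L² × L²` with its Hilbert space norm to the product. -/
noncomputable def gradientEquiv (a : ℝ) : GradientSpace a ≃L[ℂ] L2 a × L2 a × L2 a :=
  (WithLp.prodContinuousLinearEquiv 2 ℂ _ _).trans
    ((ContinuousLinearEquiv.refl ℂ (L2 a)).prodCongr (WithLp.prodContinuousLinearEquiv 2 ℂ _ _))

/-- `withGradient` with values in the Hilbert space. -/
noncomputable def gradientEmbedding {a : ℝ} (ha : 0 < a) : testFunctions →ₗ[ℂ] GradientSpace a :=
  (gradientEquiv a).symm.toLinearMap ∘ₗ withGradient ha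

/-- The first component. -/
noncomputable def gradientFst (a : ℝ) : GradientSpace a →L[ℂ] L2 a :=
  ContinuousLinearMap.fst ℂ _ _ ∘L (gradientEquiv a : GradientSpace a →L[ℂ] L2 a × L2 a × L2 a)

lemma gradientFst_gradientEmbedding {a : ℝ} (ha : 0 < a) (φ : testFunctions) :
    gradientFst a (gradientEmbedding ha φ) = toL2 ha φ := rfl

lemma inner_gradientEmbedding {a : ℝ} (ha : 0 < a) (φ ψ : testFunctions) :
    inner ℂ (gradientEmbedding ha φ) (gradientEmbedding ha ψ) =
      inner ℂ (toL2 ha φ) (toL2 ha ψ) + (inner ℂ (toL2 ha (dX φ)) (toL2 ha (dX ψ)) +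
        inner ℂ (toL2 ha (gradY ha φ)) (toL2 ha (gradY ha ψ))) := by
  rw [WithLp.prod_inner_apply, WithLp.prod_inner_apply]
  rfl

lemma norm_gradientEmbedding_sq {a : ℝ} (ha : 0 < a) (φ : testFunctions) :
    ‖gradientEmbedding ha φ‖ ^ 2 =
      ‖toL2 ha φ‖ ^ 2 + (‖toL2 ha (dX φ)‖ ^ 2 + ‖toL2 ha (gradY ha φ)‖ ^ 2) := by
  have h := inner_gradientEmbedding ha φ φ
  simp only [inner_self_eq_norm_sq_to_K] at h
  exact_mod_cast h

lemma inner_gradientEmbedding_eq {a : ℝ} (ha : 0 < a) (φ ψ : testFunctions) :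
    inner ℂ (gradientEmbedding ha φ) (gradientEmbedding ha ψ) =
      inner ℂ (gradientFst a (gradientEmbedding ha φ))
        (toL2 ha ψ - (toL2 ha ∘ₗ laplacian ha) ψ) := by
  rw [inner_gradientEmbedding, gradientFst_gradientEmbedding, inner_sub_right]
  have := inner_gradient ha φ ψ
  change inner ℂ (toL2 ha (dX φ)) (toL2 ha (dX ψ)) +
    inner ℂ (toL2 ha (gradY ha φ)) (toL2 ha (gradY ha ψ)) = _ at this
  rw [this, ← sub_eq_add_neg]
  rfl

/-- The product norm used for `H10` and the Hilbert norm define the same topology, so the closures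
of the test functions correspond. -/
lemma H10_eq {a : ℝ} (ha : 0 < a) :
    H10 ha = (formSpace (gradientEmbedding ha)).map
      (gradientFst a : GradientSpace a →ₗ[ℂ] L2 a) := by
  refine SetLike.coe_injective ?_
  have h1 : (LinearMap.range (gradientEmbedding ha) : Set (GradientSpace a)) =
      (gradientEquiv a).symm '' (LinearMap.range (withGradient ha)) := by
    rw [gradientEmbedding, LinearMap.range_comp]
    rfl
  have h2 : (formSpace (gradientEmbedding ha) : Set (GradientSpace a)) =
      (gradientEquiv a).symm '' (LinearMap.range (withGradient ha)).topologicalClosure := by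
    rw [Submodule.topologicalClosure_coe, Submodule.topologicalClosure_coe, h1]
    exact ((gradientEquiv a).symm.toHomeomorph.image_closure _).symm
  rw [Submodule.map_coe, h2, H10, Submodule.map_coe, image_image]
  refine image_congr fun v _ => ?_
  change v.1 = (gradientEquiv a ((gradientEquiv a).symm v)).1
  rw [ContinuousLinearEquiv.apply_symm_apply]

/-- The resolvent `(1 - Δ)⁻¹` of the Dirichlet Laplacian. -/
noncomputable def dirichletResolvent {a : ℝ} (ha : 0 < a) : L2 a →L[ℂ] L2 a :=
  formResolvent (gradientEmbedding ha) (gradientFst a)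

lemma isSymmetric_dirichletResolvent {a : ℝ} (ha : 0 < a) :
    (dirichletResolvent ha : L2 a →ₗ[ℂ] L2 a).IsSymmetric := isSymmetric_formResolvent _ _

lemma isResolventAtOne_dirichletLaplacian {a : ℝ} (ha : 0 < a) :
    IsResolventAtOne (dirichletLaplacian ha) (dirichletResolvent ha) := by
  rw [dirichletLaplacian, H10_eq]
  refine isResolventAtOne_formResolvent (ι := toL2 ha) (L := toL2 ha ∘ₗ laplacian ha)
    (dense_range_toL2 ha) (fun u => Iff.rfl) (fun φ => ?_) (gradientFst_gradientEmbedding ha)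
    (inner_gradientEmbedding_eq ha)
  change toL2 ha (laplacian ha ((LinearEquiv.ofInjective (toL2 ha) (toL2_injective ha)).symm
    ((LinearEquiv.ofInjective (toL2 ha) (toL2_injective ha)) φ))) = _
  rw [LinearEquiv.symm_apply_apply]
  rfl

lemma starProjection_dirichletResolvent {a : ℝ} (ha : 0 < a) (n : ℤ) (f : L2 a) :
    (modeSubspace a n).starProjection (dirichletResolvent ha f) =
      dirichletResolvent ha ((modeSubspace a n).starProjection f) := by
  set Q := (modeSubspace a n).starProjection with hQ
  have hι : ∀ φ, Q (toL2 ha φ) = toL2 ha (project n φ) := starProjection_toL2 ha n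
  refine formResolvent_commute (ι := toL2 ha) (L := toL2 ha ∘ₗ laplacian ha) (S := project n)
    -- The lift applies the mode projection to u and to both components of its gradient.
    (Q' := ((gradientEquiv a).symm : L2 a × L2 a × L2 a →L[ℂ] GradientSpace a) ∘L
      (Q.prodMap (Q.prodMap Q)) ∘L (gradientEquiv a : GradientSpace a →L[ℂ] L2 a × L2 a × L2 a))
    (gradientFst_gradientEmbedding ha) (inner_gradientEmbedding_eq ha)
    ((modeSubspace a n).starProjection_isSymmetric) (fun φ => ?_) (fun v => rfl) hι
    (fun φ => ?_) f
  · change (gradientEquiv a).symm (Q (toL2 ha φ), Q (toL2 ha (dX φ)), Q (toL2 ha (gradY ha φ))) =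
      (gradientEquiv a).symm (toL2 ha (project n φ), toL2 ha (dX (project n φ)),
        toL2 ha (gradY ha (project n φ)))
    rw [hι, hι, hι, dX_project, gradY, LinearMap.comp_apply, LinearMap.comp_apply, dY_project,
      mulX_project]
  · change Q (toL2 ha (laplacian ha φ)) = toL2 ha (laplacian ha (project n φ))
    rw [hι, laplacian_project]

lemma dirichletResolvent_mem_modeSubspace {a : ℝ} (ha : 0 < a) (n : ℤ) :
    ∀ f ∈ modeSubspace a n, dirichletResolvent ha f ∈ modeSubspace a n := by
  intro f hf
  rw [← Submodule.starProjection_eq_self_iff, starProjection_dirichletResolvent,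
    Submodule.starProjection_eq_self_iff.2 hf]

lemma dirichletResolvent_mem_orthogonal {a : ℝ} (ha : 0 < a) (n : ℤ) :
    ∀ f ∈ (modeSubspace a n)ᗮ, dirichletResolvent ha f ∈ (modeSubspace a n)ᗮ :=
  mem_orthogonal_of_isSymmetric (isSymmetric_dirichletResolvent ha)
    (dirichletResolvent_mem_modeSubspace ha n)

lemma isCompactOperator_starProjection_comp {a : ℝ} (ha : 0 < a) :
    IsCompactOperator ((harmonic a)ᗮ.starProjection ∘L dirichletResolvent ha) := by
  refine isCompactOperator_comp_formResolvent (gradientFst_gradientEmbedding ha) fun ε hε => ?_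
  obtain ⟨κ, _, g, C, h⟩ := exists_norm_sub_project_sq_le ha hε
  refine ⟨κ, inferInstance, g, C, fun φ => ?_⟩
  have e : (harmonic a)ᗮ.starProjection (toL2 ha φ) = toL2 ha (φ - project 0 φ) := by
    rw [map_sub, ← starProjection_toL2, Submodule.starProjection_orthogonal]
    rfl
  rw [e, norm_gradientEmbedding_sq]
  have h1 : 0 ≤ ε * ‖toL2 ha φ‖ ^ 2 := by positivity
  have h2 := h φ
  linarith

/-- On K the resolvent takes values in the complement of the zero mode, so composing with that
projection changes nothing. -/
lemma isCompactOperator_restrictCLM {a : ℝ} (ha : 0 < a) {K : Submodule ℂ (L2 a)}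
    (hK : IsClosed (K : Set (L2 a))) (hle : K ≤ (harmonic a)ᗮ)
    (h : ∀ f ∈ K, dirichletResolvent ha f ∈ K) :
    IsCompactOperator (restrictCLM (dirichletResolvent ha) K h : K →L[ℂ] K) := by
  have h1 := (isCompactOperator_starProjection_comp ha).comp_clm K.subtypeL
  have h2 : ∀ f : K, ((harmonic a)ᗮ.starProjection ∘L dirichletResolvent ha) (f : L2 a) =
      dirichletResolvent ha f := fun f =>
    Submodule.starProjection_eq_self_iff.2 (hle (h f f.2))
  have h3 : IsCompactOperator (dirichletResolvent ha ∘L K.subtypeL) := by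
    have e : ⇑(dirichletResolvent ha ∘L K.subtypeL) =
        ⇑((harmonic a)ᗮ.starProjection ∘L dirichletResolvent ha) ∘ ⇑K.subtypeL :=
      funext fun f => (h2 f).symm
    rw [e]
    exact h1
  exact h3.codRestrict (fun f => h f f.2) hK

lemma hasDiscreteSpectrum_restrict {a : ℝ} (ha : 0 < a) {K : Submodule ℂ (L2 a)}
    (hK : IsClosed (K : Set (L2 a))) (hle : K ≤ (harmonic a)ᗮ)
    (h : ∀ f ∈ K, dirichletResolvent ha f ∈ K) :
    HasDiscreteSpectrum (restrict (dirichletLaplacian ha) K) := by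
  have := hK.completeSpace_coe
  exact ((isResolventAtOne_dirichletLaplacian ha).restrict h).hasDiscreteSpectrum
    (isCompactOperator_restrictCLM ha hK hle h)
    (isSymmetric_restrictCLM (isSymmetric_dirichletResolvent ha) K h)

lemma modeSubspace_le_harmonic_orthogonal (a : ℝ) {n : ℤ} (hn : n ≠ 0) :
    modeSubspace a n ≤ (harmonic a)ᗮ := modeSubspace_le_orthogonal a hn.symm

/-- A spectral point z gives an eigenvalue m = (1 - z)⁻¹ of R on the mode, with 0 < m ≤ 1/(1 +
4π²n²); hence -z = 1/m - 1. -/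
lemma spectrum_restrict_modeSubspace {a : ℝ} (ha : 0 < a) {n : ℤ} (hn : n ≠ 0) {z : ℂ}
    (hz : z ∈ spectrum (restrict (dirichletLaplacian ha) (modeSubspace a n))) :
    ∃ l : ℝ, -z = l ∧ 4 * Real.pi ^ 2 * (n : ℝ) ^ 2 ≤ l := by
  have h := dirichletResolvent_mem_modeSubspace ha n
  obtain ⟨hz1, hev⟩ :=
    ((isResolventAtOne_dirichletLaplacian ha).restrict h).hasEigenvalue_of_mem_spectrum
      (isCompactOperator_restrictCLM ha (isClosed_modeSubspace a n)
        (modeSubspace_le_harmonic_orthogonal a hn) h) hz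
  have hz' : 1 - z ≠ 0 := sub_ne_zero.2 hz1.symm
  obtain ⟨f, hf⟩ := hev.exists_hasEigenvector
  have hf0 : (f : L2 a) ≠ 0 := fun h0 => hf.2 (Subtype.ext h0)
  have hRf : dirichletResolvent ha f = (1 - z)⁻¹ • (f : L2 a) :=
    congrArg Subtype.val hf.apply_eq_smul
  obtain ⟨m, hm, hm0, hmle⟩ := exists_real_of_formResolvent_eq (gradientFst_gradientEmbedding ha)
    (Q := (modeSubspace a n).starProjection) (c := 1 + 4 * Real.pi ^ 2 * (n : ℝ) ^ 2)
    (fun φ => by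
      rw [starProjection_toL2, norm_gradientEmbedding_sq]
      refine (norm_project_sq_le ha n φ).trans ?_
      gcongr
      exact le_add_of_nonneg_left (by positivity))
    hf0 (Submodule.starProjection_eq_self_iff.2 f.2) (inv_ne_zero hz') hRf
  refine ⟨m⁻¹ - 1, ?_, ?_⟩
  · rw [Complex.ofReal_sub, Complex.ofReal_inv, ← hm, inv_inv]
    simp
  · have : 1 + 4 * Real.pi ^ 2 * (n : ℝ) ^ 2 ≤ m⁻¹ := by
      rwa [← one_div, le_div_iff₀ hm0]
    linarith

end Dirichlet

end Cusp

theorem theorem2p1 (a : ℝ) (ha : 0 < a) :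
    (Cusp.Reduces (Cusp.dirichletLaplacian ha) (Cusp.harmonic a)ᗮ ∧
      Cusp.HasDiscreteSpectrum
        (Cusp.restrict (Cusp.dirichletLaplacian ha) (Cusp.harmonic a)ᗮ)) ∧
    ∀ n : ℤ, n ≠ 0 →
      Cusp.Reduces (Cusp.dirichletLaplacian ha) (Cusp.modeSubspace a n) ∧
      Cusp.HasDiscreteSpectrum
        (Cusp.restrict (Cusp.dirichletLaplacian ha) (Cusp.modeSubspace a n)) ∧
      ∀ z ∈ Cusp.spectrum (-Cusp.restrict (Cusp.dirichletLaplacian ha) (Cusp.modeSubspace a n)),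
        ∃ l : ℝ, z = l ∧ 4 * Real.pi ^ 2 * (n : ℝ) ^ 2 ≤ l := by
  have hR := Cusp.isResolventAtOne_dirichletLaplacian ha
  refine ⟨⟨?_, ?_⟩, fun n hn => ⟨?_, ?_, fun z hz => ?_⟩⟩
  -- Here K is already an orthogonal complement; symmetry of R yields the invariance of its own
  -- complement.
  · exact hR.reduces (Cusp.dirichletResolvent_mem_orthogonal ha 0)
      (Cusp.mem_orthogonal_of_isSymmetric (Cusp.isSymmetric_dirichletResolvent ha)
        (Cusp.dirichletResolvent_mem_orthogonal ha 0))
  · exact Cusp.hasDiscreteSpectrum_restrict ha (Submodule.isClosed_orthogonal _) le_rfl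
      (Cusp.dirichletResolvent_mem_orthogonal ha 0)
  · exact hR.reduces (Cusp.dirichletResolvent_mem_modeSubspace ha n)
      (Cusp.dirichletResolvent_mem_orthogonal ha n)
  · exact Cusp.hasDiscreteSpectrum_restrict ha (Cusp.isClosed_modeSubspace a n)
      (Cusp.modeSubspace_le_harmonic_orthogonal a hn) (Cusp.dirichletResolvent_mem_modeSubspace ha n)
  · simpa using Cusp.spectrum_restrict_modeSubspace ha hn
      (Cusp.neg_mem_spectrum_of_mem_spectrum_neg hz)
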